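/- Let $X, U, Y$ be real Hilbert spaces, let $A : \mathcal D(A) \to X$ be the infinitesimal generator of a strongly continuous semigroup on $X$, and consider the cascade $$\dot x = Ax + f(x) + g(x)u, \qquad \dot z = Sz + Cx + h(x),$$ where $f : X \to X$, $g : X \to \mathcal L(U, X)$ and $h : X \to Y$ are Lipschitz continuous on every bounded subset of $X$, $f(0) = 0$, $h(0) = 0$, $C : \mathcal D(A) \to Y$ is linear and bounded for the graph norm of $A$, and $S \in \mathcal L(Y)$ satisfies $S^* = -S$. Call $V \in \mathcal C^1(X, \mathbb R)$ quadratic-like if there are $m_1, m_2 > 0$ with $m_1\|x\|^2 \le V(x) \le m_2\|x\|^2$ for all $x \in X$. Assume the following. (1) (Semiglobal ISS) There exist a quadratic-like $V \in \mathcal C^1(X, \mathbb R)$ and $\beta > 0$ such that $dV(x)[Ax + f(x) + g(x)u] \le \beta\|u\|^2$ for all $x \in \mathcal D(A)$ and $u \in U$. Moreover, for every bounded open set $\mathcal B \subset X$ there exist a quadratic-like $V_{\mathcal B} \in \mathcal C^1(X, \mathbb R)$ and $\alpha_{\mathcal B}, \beta_{\mathcal B} > 0$ such that $dV_{\mathcal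 B}(x)[Ax + f(x) + g(x)u] \le -\alpha_{\mathcal B} V_{\mathcal B}(x) + \beta_{\mathcal B}\|u\|^2$ for all $x \in \mathcal D(A) \cap \mathcal B$ and $u \in U$. (2) (Invariant graph) $\mathcal M \in \mathcal C^1(X, Y)$ is a map such that $d\mathcal M$ is Lipschitz continuous on bounded sets, $\mathcal M(0) = 0$, and $d\mathcal M(x)(Ax + f(x)) = S\mathcal M(x) + Cx + h(x)$ for all $x \in \mathcal D(A)$. (3) (Range condition) $\operatorname{range} d\mathcal M(0)g(0) = Y$. Then the zero equilibrium of the cascade in closed loop with the feedback $u = g(x)^* d\mathcal M(x)^*[z - \mathcal M(x)]$ is locally exponentially stable: there exist $\delta, K, \omega > 0$ such that, for all initial data $[x_0, z_0] \in X \times Y$ with $\|[x_0, z_0]\| < \delta$, the closed-loop system has a unique global mild solution $[x, z] \in \mathcal C([0, \infty), X \times Y)$ starting at $[x_0, z_0]$, and $\|[x(t), z(t)]\| \le K e^{-\omega t}\|[x_0, z_0]\|$ for all $t \ge 0$. Here a mild solution is one that satisfies the variation of constants formula for the strongly continuous semigroup on $X \times Y$ generated by $[x, z] \mapsto [Ax,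 Cx]$ with domain $\mathcal D(A) \times Y$, all remaining terms being treated as a perturbation. -/

import Mathlib

open scoped NNReal Topology

noncomputable section

/-- A strongly continuous semigroup of bounded linear operators on a real normed space. -/
structure C0Semigroup (E : Type*) [NormedAddCommGroup E] [NormedSpace ℝ E] where
  /-- The operator at time `t ≥ 0`. -/
  op : ℝ≥0 → E →L[ℝ] E
  op_zero : op 0 = ContinuousLinearMap.id ℝ E
  op_add : ∀ s t : ℝ≥0, op (s + t) = (op s).comp (op t)
  strong_continuous : ∀ x : E, Continuous fun t : ℝ≥0 => op t x

/-- The (partially defined) operator `L` is the infinitesimal generator of the semigroup `T`: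
`x` lies in the domain of `L` and `L x = y` exactly when `(T t x - x) / t` tends to `y`
as `t` decreases to `0`. -/
def C0Semigroup.HasGenerator {E : Type*} [NormedAddCommGroup E] [NormedSpace ℝ E]
    (T : C0Semigroup E) (L : E →ₗ.[ℝ] E) : Prop :=
  ∀ x y : E, (∃ hx : x ∈ L.domain, L ⟨x, hx⟩ = y) ↔
    Filter.Tendsto (fun t : ℝ≥0 => (t : ℝ)⁻¹ • (T.op t x - x)) (𝓝[>] 0) (𝓝 y)

/-- Lipschitz continuity on every bounded subset. -/
def LipschitzOnBounded {E F : Type*} [NormedAddCommGroup E] [NormedAddCommGroup F]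
    (f : E → F) : Prop :=
  ∀ B : Set E, Bornology.IsBounded B → ∃ K : ℝ≥0, LipschitzOnWith K f B

/-- `w` is a global mild solution, on `[0, ∞)`, of `w' = L w + F w`, where `L` generates a strongly
continuous semigroup: `w` is continuous and satisfies the variation of constants formula.
A generator determines its semigroup, so the semigroup in the definition is unique. -/
def IsMildSolution {E : Type*} [NormedAddCommGroup E] [NormedSpace ℝ E]
    (L : E →ₗ.[ℝ] E) (F : E → E) (w : ℝ → E) : Prop :=
  ContinuousOn w (Set.Ici 0) ∧
    ∃ T : C0Semigroup E, T.HasGenerator L ∧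
      ∀ t : ℝ, 0 ≤ t →
        w t = T.op t.toNNReal (w 0) + ∫ s in (0 : ℝ)..t, T.op (t - s).toNNReal (F (w s))

/-- Local exponential stability of the zero equilibrium of `w' = L w + F w`: for all initial data
in some ball around zero there is exactly one global mild solution, and it decays
exponentially, with uniform constants. -/
def LocallyExponentiallyStable {E : Type*} [NormedAddCommGroup E] [NormedSpace ℝ E]
    (L : E →ₗ.[ℝ] E) (F : E → E) : Prop :=
  ∃ δ K ω : ℝ, 0 < δ ∧ 0 < K ∧ 0 < ω ∧ ∀ w₀ : E, ‖w₀‖ < δ →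
    ∃ w : ℝ → E, w 0 = w₀ ∧ IsMildSolution L F w ∧
      (∀ v : ℝ → E, v 0 = w₀ → IsMildSolution L F v → ∀ t : ℝ, 0 ≤ t → v t = w t) ∧
      ∀ t : ℝ, 0 ≤ t → ‖w t‖ ≤ K * Real.exp (-ω * t) * ‖w₀‖

/-- A continuously differentiable functional with quadratic lower and upper bounds. -/
def IsQuadraticLike {X : Type*} [NormedAddCommGroup X] [NormedSpace ℝ X] (V : X → ℝ) : Prop :=
  ContDiff ℝ 1 V ∧ ∃ m₁ m₂ : ℝ, 0 < m₁ ∧ 0 < m₂ ∧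
    ∀ x : X, m₁ * ‖x‖ ^ 2 ≤ V x ∧ V x ≤ m₂ * ‖x‖ ^ 2

/-- Semiglobal input-to-state stability of `x' = A x + f x + g x u`. -/
def SemiglobalISS {X U : Type*} [NormedAddCommGroup X] [NormedSpace ℝ X]
    [NormedAddCommGroup U] [NormedSpace ℝ U]
    (A : X →ₗ.[ℝ] X) (f : X → X) (g : X → U →L[ℝ] X) : Prop :=
  (∃ V : X → ℝ, IsQuadraticLike V ∧ ∃ β : ℝ, 0 < β ∧
    ∀ (x : A.domain) (u : U),
      fderiv ℝ V (x : X) (A x + f x + g x u) ≤ β * ‖u‖ ^ 2) ∧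
  ∀ B : Set X, IsOpen B → Bornology.IsBounded B →
    ∃ V : X → ℝ, IsQuadraticLike V ∧ ∃ α β : ℝ, 0 < α ∧ 0 < β ∧
      ∀ (x : A.domain) (u : U), (x : X) ∈ B →
        fderiv ℝ V (x : X) (A x + f x + g x u) ≤ -α * V x + β * ‖u‖ ^ 2

/-- The graph of `M` is an invariant manifold of the uncontrolled cascade
`x' = A x + f x`, `z' = S z + C x + h x`. -/
structure IsInvariantGraph {X Y : Type*} [NormedAddCommGroup X] [NormedSpace ℝ X]
    [NormedAddCommGroup Y] [NormedSpace ℝ Y]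
    (A : X →ₗ.[ℝ] X) (f : X → X) (C : A.domain →ₗ[ℝ] Y) (h : X → Y) (S : Y →L[ℝ] Y)
    (M : X → Y) : Prop where
  contDiff : ContDiff ℝ 1 M
  lipschitz_fderiv : LipschitzOnBounded (fderiv ℝ M)
  map_zero : M 0 = 0
  sylvester : ∀ x : A.domain, fderiv ℝ M (x : X) (A x + f x) = S (M x) + (C x + h x)

/-- The linear operator `(x, z) ↦ (A x, C x)` on `X × Y`, with domain `D(A) × Y`. -/
def cascadeOperator {X Y : Type*} [NormedAddCommGroup X] [NormedSpace ℝ X]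
    [NormedAddCommGroup Y] [NormedSpace ℝ Y]
    (A : X →ₗ.[ℝ] X) (C : A.domain →ₗ[ℝ] Y) : (X × Y) →ₗ.[ℝ] (X × Y) where
  domain := A.domain.prod ⊤
  toFun :=
    { toFun := fun w => (A ⟨w.1.1, w.2.1⟩, C ⟨w.1.1, w.2.1⟩)
      map_add' := fun v w => Prod.ext
        (A.map_add ⟨v.1.1, v.2.1⟩ ⟨w.1.1, w.2.1⟩) (C.map_add ⟨v.1.1, v.2.1⟩ ⟨w.1.1, w.2.1⟩)
      map_smul' := fun c w => Prod.ext
        (A.map_smul c ⟨w.1.1, w.2.1⟩) (C.map_smul c ⟨w.1.1, w.2.1⟩) }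

/-- The forwarding feedback `u = g(x)* dM(x)* (z - M x)`. -/
def forwardingFeedback {X U Y : Type*}
    [NormedAddCommGroup X] [InnerProductSpace ℝ X] [CompleteSpace X]
    [NormedAddCommGroup U] [InnerProductSpace ℝ U] [CompleteSpace U]
    [NormedAddCommGroup Y] [InnerProductSpace ℝ Y] [CompleteSpace Y]
    (g : X → U →L[ℝ] X) (M : X → Y) (x : X) (z : Y) : U :=
  ContinuousLinearMap.adjoint (g x) (ContinuousLinearMap.adjoint (fderiv ℝ M x) (z - M x))

/-- The remaining (everywhere defined) part of the closed-loop equations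
`x' = A x + f x + g x u`, `z' = S z + C x + h x` with `u` the forwarding feedback. -/
def closedLoopPerturbation {X U Y : Type*}
    [NormedAddCommGroup X] [InnerProductSpace ℝ X] [CompleteSpace X]
    [NormedAddCommGroup U] [InnerProductSpace ℝ U] [CompleteSpace U]
    [NormedAddCommGroup Y] [InnerProductSpace ℝ Y] [CompleteSpace Y]
    (f : X → X) (g : X → U →L[ℝ] X) (h : X → Y) (S : Y →L[ℝ] Y) (M : X → Y)
    (w : X × Y) : X × Y :=
  (f w.1 + g w.1 (forwardingFeedback g M w.1 w.2), S w.2 + h w.1)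

end

/-!
The functional `Φ(x, z) = V(x) + β ‖z - M x‖²` is a strict Lyapunov function for the closed loop
near the origin, where `V` is the local ISS functional on a small ball and `β` its input gain.
Write `η = z - M x` and let `u` be the feedback. The invariance equation for `M` cancels the
unbounded terms `A x` and `C x` in the derivative of `η`, which leaves `η' = S η - dM(x) g(x) u`.
As `S` is skew-adjoint and `u = (dM(x) g(x))* η`, the derivative of `β ‖η‖²` is `-2 β ‖u‖²`. It
dominates the input term `β ‖u‖²` in the ISS inequality for `V`, so `Φ' ≤ -α V - β ‖u‖²`. The
range condition and the open mapping theorem give `‖u‖ ≥ c ‖η‖` for `x` near `0`, hence `Φ' ≤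
-min(α, c²) Φ`.

This computation only makes sense on the domain of the generator, which a mild solution `w` need
not meet. The averages `(1/r) ∫₀ʳ T(s) w(t) ds` do lie in the domain and have right derivatives in
`t` that solve an averaged equation (`C0Semigroup.HasGenerator.hasDerivWithinAt_avg`). The upper
bound for `Φ'` can be written as a jointly continuous function of state and forcing in which the
unbounded operators no longer appear, so the inequality survives `r → 0`, uniformly on compact
time intervals (`C0Semigroup.HasGenerator.lyapunov_decay`). No classical solutions are needed.

Global existence, uniqueness and decay then follow from
`C0Semigroup.HasGenerator.locallyExponentiallyStable`. The perturbation is truncated to a globally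
Lipschitz one, for which mild solutions exist by contraction in an exponentially weighted norm
(`C0Semigroup.exists_mild`), and the decay of `Φ` keeps small solutions away from the truncation.
Uniqueness rests on Gronwall's inequality and on the fact that a generator determines its
semigroup (`C0Semigroup.HasGenerator.op_eq`). That the cascade operator is a generator at all is
shown by the explicit semigroup `(x, z) ↦ (T(t) x, z + C ∫₀ᵗ T(s) x ds)`, for which graph-norm
boundedness of `C` is enough (`C0Semigroup.hasGenerator_cascade`).
-/

/-! ### Strongly continuous semigroups and their generators -/

namespace C0Semigroup

variable {E : Type*} [NormedAddCommGroup E] [NormedSpace ℝ E]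

theorem op_add_apply (T : C0Semigroup E) (s t : ℝ≥0) (x : E) :
    T.op (s + t) x = T.op s (T.op t x) := by
  rw [T.op_add]; rfl

theorem op_comm (T : C0Semigroup E) (s t : ℝ≥0) (x : E) :
    T.op s (T.op t x) = T.op t (T.op s x) := by
  rw [← T.op_add_apply, ← T.op_add_apply, add_comm]

theorem op_zero_apply (T : C0Semigroup E) (x : E) : T.op 0 x = x := by
  rw [T.op_zero]; rfl

theorem tendsto_coe_nhdsGT_zero :
    Filter.Tendsto (fun t : ℝ≥0 => (t : ℝ)) (𝓝[>] 0) (𝓝[>] 0) := by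
  refine tendsto_nhdsWithin_iff.2 ⟨?_, ?_⟩
  · exact ((NNReal.continuous_coe.tendsto 0).mono_left nhdsWithin_le_nhds)
  · filter_upwards [self_mem_nhdsWithin] with t ht
    exact NNReal.coe_pos.2 ht

theorem tendsto_toNNReal_nhdsGT_zero :
    Filter.Tendsto Real.toNNReal (𝓝[>] 0) (𝓝[>] 0) := by
  refine tendsto_nhdsWithin_iff.2 ⟨?_, ?_⟩
  · simpa using ((continuous_real_toNNReal.tendsto 0).mono_left nhdsWithin_le_nhds)
  · filter_upwards [self_mem_nhdsWithin] with t ht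
    exact Real.toNNReal_pos.2 ht

theorem HasGenerator.tendsto {T : C0Semigroup E} {L : E →ₗ.[ℝ] E} (hL : T.HasGenerator L)
    (x : L.domain) :
    Filter.Tendsto (fun t : ℝ => t⁻¹ • (T.op t.toNNReal x - x)) (𝓝[>] 0) (𝓝 (L x)) := by
  refine (((hL x (L x)).1 ⟨x.2, rfl⟩).comp tendsto_toNNReal_nhdsGT_zero).congr' ?_
  filter_upwards [self_mem_nhdsWithin] with t ht
  simp [Real.coe_toNNReal t (le_of_lt ht)]

/-- The domain of the generator is invariant under the semigroup. -/
theorem HasGenerator.op_mem {T : C0Semigroup E} {L : E →ₗ.[ℝ] E} (hL : T.HasGenerator L)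
    (t : ℝ≥0) (x : L.domain) : T.op t x ∈ L.domain := by
  have h := ((T.op t).continuous.tendsto _).comp ((hL x (L x)).1 ⟨x.2, rfl⟩)
  refine ((hL (T.op t x) (T.op t (L x))).2 (h.congr fun s => ?_)).1
  simp only [Function.comp, map_smul, map_sub]
  rw [op_comm]

/-- Local boundedness of a strongly continuous semigroup, from the Banach–Steinhaus theorem. -/
theorem exists_norm_op_le [CompleteSpace E] (T : C0Semigroup E) (b : ℝ≥0) :
    ∃ K : ℝ, 1 ≤ K ∧ ∀ t ≤ b, ‖T.op t‖ ≤ K := by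
  obtain ⟨K, hK⟩ := banach_steinhaus (g := fun t : Set.Icc (0 : ℝ≥0) b => T.op t) (by
    intro x
    obtain ⟨K, hK⟩ := (isCompact_Icc (a := (0 : ℝ≥0)) (b := b)).exists_bound_of_continuousOn
      (T.strong_continuous x).continuousOn
    exact ⟨K, fun t => hK t t.2⟩)
  exact ⟨max 1 K, le_max_left _ _, fun t ht => (hK ⟨t, zero_le, ht⟩).trans (le_max_right _ _)⟩

/-- A strongly continuous semigroup acts jointly continuously in time and state. -/
theorem continuous_op_apply [CompleteSpace E] (T : C0Semigroup E) :
    Continuous fun p : ℝ≥0 × E => T.op p.1 p.2 := by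
  rw [continuous_iff_continuousAt]
  rintro ⟨t, x⟩
  obtain ⟨K, -, hK⟩ := T.exists_norm_op_le (t + 1)
  have h1 : Filter.Tendsto (fun p : ℝ≥0 × E => T.op p.1 x) (𝓝 (t, x)) (𝓝 (T.op t x)) :=
    ((T.strong_continuous x).comp continuous_fst).tendsto (t, x)
  have h2 : Filter.Tendsto (fun p : ℝ≥0 × E => T.op p.1 (p.2 - x)) (𝓝 (t, x)) (𝓝 0) := by
    have h3 : Filter.Tendsto (fun p : ℝ≥0 × E => K * ‖p.2 - x‖) (𝓝 (t, x)) (𝓝 0) := by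
      have : Continuous fun p : ℝ≥0 × E => K * ‖p.2 - x‖ := by fun_prop
      simpa using this.tendsto (t, x)
    refine squeeze_zero_norm' ?_ h3
    have h4 : ∀ᶠ p : ℝ≥0 × E in 𝓝 (t, x), p.1 < t + 1 :=
      (continuous_fst.tendsto (t, x)).eventually_lt_const (lt_add_one t)
    filter_upwards [h4] with p hp
    exact (T.op p.1).le_of_opNorm_le (hK _ hp.le) _
  simpa [ContinuousAt] using h1.add h2

/-- Exponential growth bound for a strongly continuous semigroup: write `t = n + r` with `r ≤ 1` and
bound `T(t) = T(1)ⁿ T(r)` by a power of a bound on `[0, 1]`. -/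
theorem exists_norm_op_le_exp [CompleteSpace E] (T : C0Semigroup E) :
    ∃ K ω : ℝ, 1 ≤ K ∧ ∀ t : ℝ≥0, ‖T.op t‖ ≤ K * Real.exp (ω * t) := by
  obtain ⟨K, h1, hK⟩ := T.exists_norm_op_le 1
  have hpos : 0 < K := by linarith
  have key : ∀ n : ℕ, ∀ t : ℝ≥0, t ≤ 1 → ‖T.op (n + t)‖ ≤ K ^ n * K := by
    intro n
    induction n with
    | zero => intro t ht; simpa using hK t ht
    | succ n ih =>
      intro t ht
      have : ((n + 1 : ℕ) : ℝ≥0) + t = 1 + (n + t) := by push_cast; ring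
      rw [this, T.op_add, pow_succ' K n, mul_assoc]
      exact ((T.op 1).opNorm_comp_le _).trans
        (mul_le_mul (hK 1 le_rfl) (ih t ht) (norm_nonneg _) hpos.le)
  refine ⟨K, Real.log K, h1, fun t => ?_⟩
  obtain ⟨r, hr⟩ := exists_add_of_le (Nat.floor_le (zero_le (a := t)))
  have hr1 : r ≤ 1 := by
    have : (⌊t⌋₊ : ℝ≥0) + r ≤ ⌊t⌋₊ + 1 := hr ▸ (Nat.lt_floor_add_one t).le
    simpa using this
  rw [hr]
  refine (key _ r hr1).trans ?_
  rw [mul_comm, ← hr]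
  gcongr
  rw [← Real.rpow_def_of_pos hpos, ← Real.rpow_natCast]
  exact Real.rpow_le_rpow_of_exponent_le h1 (by exact_mod_cast Nat.floor_le (zero_le (a := t)))

theorem continuous_op_toNNReal [CompleteSpace E] (T : C0Semigroup E) {α : Type*}
    [TopologicalSpace α] {a : α → ℝ} {v : α → E} (ha : Continuous a) (hv : Continuous v) :
    Continuous fun p => T.op (a p).toNNReal (v p) :=
  T.continuous_op_apply.comp ((continuous_real_toNNReal.comp ha).prodMk hv)

theorem continuous_orbit (T : C0Semigroup E) (x : E) :
    Continuous fun s : ℝ => T.op s.toNNReal x :=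
  (T.strong_continuous x).comp continuous_real_toNNReal

/-- The average `∫₀¹ T(r s) x ds` of the orbit of `x` over `[0, r]`, for `r > 0`.
Written in this form it is also defined, and continuous, at `r = 0`, where it is the identity. -/
noncomputable def avg [CompleteSpace E] (T : C0Semigroup E) (r : ℝ) : E →L[ℝ] E where
  toFun x := ∫ s in (0 : ℝ)..1, T.op (r * s).toNNReal x
  map_add' x y := by
    simp only [map_add]
    have h : ∀ v : E, IntervalIntegrable (fun s => T.op (r * s).toNNReal v)
        MeasureTheory.volume 0 1 := fun v =>
      ((T.continuous_orbit v).comp (continuous_const_mul r)).intervalIntegrable 0 1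
    exact intervalIntegral.integral_add (h x) (h y)
  map_smul' c x := by simp
  cont := by
    refine intervalIntegral.continuous_parametric_intervalIntegral_of_continuous' ?_ 0 1
    exact T.continuous_op_toNNReal (by fun_prop) continuous_fst

variable [CompleteSpace E]

theorem avg_apply (T : C0Semigroup E) (r : ℝ) (x : E) :
    T.avg r x = ∫ s in (0 : ℝ)..1, T.op (r * s).toNNReal x := rfl

theorem avg_zero (T : C0Semigroup E) (x : E) : T.avg 0 x = x := by
  simp [avg_apply, op_zero_apply]

theorem continuous_avg_apply (T : C0Semigroup E) :
    Continuous fun p : ℝ × E => T.avg p.1 p.2 := by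
  refine intervalIntegral.continuous_parametric_intervalIntegral_of_continuous' ?_ 0 1
  exact T.continuous_op_toNNReal (by fun_prop) (by fun_prop)

theorem op_avg (T : C0Semigroup E) (t : ℝ≥0) (r : ℝ) (x : E) :
    T.op t (T.avg r x) = T.avg r (T.op t x) := by
  rw [avg_apply, avg_apply, ← ContinuousLinearMap.intervalIntegral_comp_comm]
  · exact intervalIntegral.integral_congr fun s _ => T.op_comm _ _ _
  · exact (T.continuous_op_toNNReal (by fun_prop) continuous_const).intervalIntegrable _ _

/-- Scaling back, `r • avg r x` is the integral of the orbit of `x` over `[0, r]`. -/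
theorem smul_avg (T : C0Semigroup E) (r : ℝ) (x : E) :
    r • T.avg r x = ∫ s in (0 : ℝ)..r, T.op s.toNNReal x := by
  rw [avg_apply, intervalIntegral.smul_integral_comp_mul_left
    (fun s => T.op s.toNNReal x)]
  simp

theorem hasDerivAt_smul_avg (T : C0Semigroup E) (r : ℝ) (x : E) :
    HasDerivAt (fun r => r • T.avg r x) (T.op r.toNNReal x) r := by
  simp only [smul_avg]
  exact intervalIntegral.integral_hasDerivAt_right
    ((T.continuous_orbit x).intervalIntegrable _ _)
    ((T.continuous_orbit x).stronglyMeasurableAtFilter _ _)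
    (T.continuous_orbit x).continuousAt

theorem op_smul_avg (T : C0Semigroup E) (t r : ℝ≥0) (x : E) :
    T.op t ((r : ℝ) • T.avg r x)
      = ((r + t : ℝ≥0) : ℝ) • T.avg (r + t : ℝ≥0) x - (t : ℝ) • T.avg t x := by
  have hi : ∀ a b : ℝ, IntervalIntegrable (fun s => T.op s.toNNReal x) MeasureTheory.volume a b :=
    fun a b => (T.continuous_orbit x).intervalIntegrable a b
  rw [smul_avg, smul_avg, smul_avg, ← ContinuousLinearMap.intervalIntegral_comp_comm _ (hi _ _),
    intervalIntegral.integral_interval_sub_left (hi _ _) (hi _ _)]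
  have h1 := intervalIntegral.integral_comp_add_right (a := 0) (b := (r : ℝ))
    (fun s => T.op s.toNNReal x) (t : ℝ)
  rw [zero_add, ← NNReal.coe_add] at h1
  rw [← h1]
  refine intervalIntegral.integral_congr fun s hs => ?_
  rw [Set.uIcc_of_le (NNReal.coe_nonneg r)] at hs
  change T.op t (T.op s.toNNReal x) = T.op (s + (t : ℝ)).toNNReal x
  rw [← op_add_apply, Real.toNNReal_add hs.1 (NNReal.coe_nonneg t), Real.toNNReal_coe, add_comm]

/-- Averages of orbits lie in the domain of the generator. -/
theorem HasGenerator.smul_avg_mem {T : C0Semigroup E} {L : E →ₗ.[ℝ] E} (hL : T.HasGenerator L)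
    (r : ℝ≥0) (x : E) :
    ∃ hx : (r : ℝ) • T.avg r x ∈ L.domain, L ⟨_, hx⟩ = T.op r x - x := by
  refine (hL _ _).2 ?_
  have h0 := (T.hasDerivAt_smul_avg 0 x)
  have h2 := (T.hasDerivAt_smul_avg (r : ℝ) x).tendsto_slope_zero_right
  have h3 := h0.tendsto_slope_zero_right
  have h4 := (h2.sub h3).comp tendsto_coe_nhdsGT_zero
  rw [Real.toNNReal_coe, Real.toNNReal_zero, op_zero_apply] at h4
  refine h4.congr fun t => ?_
  simp only [Function.comp, op_smul_avg, zero_add, zero_smul, sub_zero, NNReal.coe_add]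
  rw [← smul_sub]
  congr 1
  abel

theorem HasGenerator.avg_mem {T : C0Semigroup E} {L : E →ₗ.[ℝ] E} (hL : T.HasGenerator L)
    {r : ℝ} (hr : 0 < r) (x : E) : T.avg r x ∈ L.domain := by
  obtain ⟨hx, -⟩ := hL.smul_avg_mem ⟨r, hr.le⟩ x
  have := L.domain.smul_mem r⁻¹ hx
  change r⁻¹ • r • T.avg r x ∈ L.domain at this
  rwa [smul_smul, inv_mul_cancel₀ hr.ne', one_smul] at this

/-- A generator determines its semigroup: for `x` in the domain, `s ↦ T(t - s) T'(s) x` has right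
derivative zero on `[0, t)`, so its values at `0` and `t` agree; the domain is dense. -/
theorem HasGenerator.op_eq {T T' : C0Semigroup E} {L : E →ₗ.[ℝ] E} (hL : T.HasGenerator L)
    (hL' : T'.HasGenerator L) : T.op = T'.op := by
  have key : ∀ (t : ℝ≥0) (x : L.domain), T'.op t x = T.op t x := by
    intro t x
    have hcont : Continuous fun s : ℝ => T.op ((t : ℝ) - s).toNNReal (T'.op s.toNNReal x) :=
      T.continuous_op_toNNReal (by fun_prop) (T'.continuous_op_toNNReal continuous_id
        continuous_const)
    have h := constant_of_has_deriv_right_zero (a := 0) (b := (t : ℝ)) hcont.continuousOn (by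
      intro s hs
      set y : L.domain := ⟨T'.op s.toNNReal x, hL'.op_mem _ x⟩ with hy
      obtain ⟨K, -, hK⟩ := T.exists_norm_op_le t
      have h1 := (hL'.tendsto y).sub (hL.tendsto y)
      rw [sub_self] at h1
      have h2 : Filter.Tendsto (fun q : ℝ => T.op ((t : ℝ) - s - q).toNNReal
          (q⁻¹ • (T'.op q.toNNReal y - y) - q⁻¹ • (T.op q.toNNReal y - y))) (𝓝[>] 0) (𝓝 0) := by
        have h3 := h1.norm.const_mul K
        rw [norm_zero, mul_zero] at h3
        refine squeeze_zero_norm' ?_ h3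
        filter_upwards [self_mem_nhdsWithin] with q hq
        refine (T.op _).le_of_opNorm_le (hK _ ?_) _
        rw [Real.toNNReal_le_iff_le_coe]
        have := hs.1
        have : 0 < q := hq
        linarith
      rw [← hasDerivWithinAt_Ioi_iff_Ici, hasDerivWithinAt_iff_tendsto_slope' (by simp)]
      have h4 : Filter.Tendsto (fun q : ℝ => q - s) (𝓝[>] s) (𝓝[>] 0) := by
        refine tendsto_nhdsWithin_iff.2 ⟨?_, ?_⟩
        · have : Continuous fun q : ℝ => q - s := by fun_prop
          simpa using (this.tendsto s).mono_left nhdsWithin_le_nhds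
        · filter_upwards [self_mem_nhdsWithin] with q hq
          exact sub_pos.2 (Set.mem_Ioi.1 hq)
      refine (h2.comp h4).congr' ?_
      filter_upwards [Ioo_mem_nhdsGT hs.2] with q hq
      have e1 : T'.op q.toNNReal x = T'.op (q - s).toNNReal y := by
        rw [hy, ← op_add_apply, ← Real.toNNReal_add (by linarith [hq.1]) hs.1]
        simp
      have e2 : T.op ((t : ℝ) - s).toNNReal y
          = T.op ((t : ℝ) - q).toNNReal (T.op (q - s).toNNReal y) := by
        rw [← op_add_apply, ← Real.toNNReal_add (by linarith [hq.2]) (by linarith [hq.1])]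
        congr 3
        ring
      simp only [Function.comp, slope, vsub_eq_sub]
      rw [e1, show T'.op s.toNNReal x = (y : E) from rfl, e2,
        show (t : ℝ) - s - (q - s) = t - q by ring]
      simp only [map_smul, map_sub, ← smul_sub]
      congr 1
      abel) t ⟨t.2, le_rfl⟩
    simpa [op_zero_apply] using h
  funext t
  ext x
  have hT : ∀ T : C0Semigroup E, Filter.Tendsto (fun r : ℝ => T.op t (T'.avg r x))
      (𝓝[>] 0) (𝓝 (T.op t x)) := by
    intro T
    have : Continuous fun r : ℝ => T.op t (T'.avg r x) :=
      (T.op t).continuous.comp (T'.continuous_avg_apply.comp (continuous_id.prodMk continuous_const))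
    simpa [avg_zero] using (this.tendsto 0).mono_left (nhdsWithin_le_nhds (s := Set.Ioi 0))
  refine tendsto_nhds_unique (hT T) ((hT T').congr' ?_)
  filter_upwards [self_mem_nhdsWithin] with r hr
  exact key t ⟨_, hL'.avg_mem hr x⟩

end C0Semigroup

/-! ### Lyapunov functions along mild solutions -/

namespace C0Semigroup

variable {E : Type*} [NormedAddCommGroup E] [NormedSpace ℝ E] [CompleteSpace E]

/-- The variation of constants formula restarted at time `t`. -/
theorem mild_add {T : C0Semigroup E} {w b : ℝ → E} (hb : Continuous b)
    (hw : ∀ t : ℝ, 0 ≤ t →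
      w t = T.op t.toNNReal (w 0) + ∫ s in (0 : ℝ)..t, T.op (t - s).toNNReal (b s))
    {t q : ℝ} (ht : 0 ≤ t) (hq : 0 ≤ q) :
    w (t + q) = T.op q.toNNReal (w t) + ∫ s in t..(t + q), T.op (t + q - s).toNNReal (b s) := by
  have hi : ∀ c a d : ℝ, IntervalIntegrable (fun s => T.op (c - s).toNNReal (b s))
      MeasureTheory.volume a d := fun c a d =>
    (T.continuous_op_toNNReal (by fun_prop) hb).intervalIntegrable a d
  rw [hw (t + q) (by positivity), hw t ht, map_add, ← op_add_apply,
    ← Real.toNNReal_add hq ht, add_comm q t, add_assoc,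
    ← ContinuousLinearMap.intervalIntegral_comp_comm _ (hi _ _ _),
    ← intervalIntegral.integral_add_adjacent_intervals (hi (t + q) 0 t) (hi (t + q) t (t + q))]
  congr 2
  refine intervalIntegral.integral_congr fun s hs => ?_
  rw [Set.uIcc_of_le ht] at hs
  change T.op (t + q - s).toNNReal (b s) = T.op q.toNNReal (T.op (t - s).toNNReal (b s))
  rw [← op_add_apply, ← Real.toNNReal_add hq (by linarith [hs.2])]
  congr 3
  ring

theorem tendsto_inv_smul_integral (T : C0Semigroup E) {b : ℝ → E} (hb : Continuous b) (t : ℝ) :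
    Filter.Tendsto (fun q : ℝ => q⁻¹ • ∫ s in t..(t + q), T.op (t + q - s).toNNReal (b s))
      (𝓝[>] 0) (𝓝 (b t)) := by
  have hc : Continuous fun q : ℝ =>
      ∫ σ in (0 : ℝ)..1, T.op (q - q * σ).toNNReal (b (t + q * σ)) := by
    refine intervalIntegral.continuous_parametric_intervalIntegral_of_continuous' ?_ 0 1
    exact T.continuous_op_toNNReal (by fun_prop) (by fun_prop)
  have h0 := (hc.tendsto 0).mono_left (nhdsWithin_le_nhds (s := Set.Ioi 0))
  simp only [zero_mul, sub_zero, Real.toNNReal_zero, op_zero_apply, add_zero,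
    intervalIntegral.integral_const, one_smul] at h0
  refine h0.congr' ?_
  filter_upwards [self_mem_nhdsWithin] with q hq
  have h1 := intervalIntegral.smul_integral_comp_add_mul (a := 0) (b := 1)
    (fun s => T.op (t + q - s).toNNReal (b s)) q t
  rw [mul_zero, mul_one, add_zero] at h1
  rw [← h1, smul_smul, inv_mul_cancel₀ (ne_of_gt hq), one_smul]
  refine intervalIntegral.integral_congr fun σ _ => ?_
  congr 3
  ring

/-- Averaging a mild solution along the semigroup gives a curve in the domain of the generator that
solves the averaged equation, in the sense of right derivatives. -/
theorem HasGenerator.hasDerivWithinAt_avg {T : C0Semigroup E} {L : E →ₗ.[ℝ] E}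
    (hL : T.HasGenerator L) {w b : ℝ → E} (hb : Continuous b)
    (hw : ∀ t : ℝ, 0 ≤ t →
      w t = T.op t.toNNReal (w 0) + ∫ s in (0 : ℝ)..t, T.op (t - s).toNNReal (b s))
    {r t : ℝ} (hr : 0 < r) (ht : 0 ≤ t) :
    HasDerivWithinAt (fun s => T.avg r (w s))
      (L ⟨T.avg r (w t), hL.avg_mem hr _⟩ + T.avg r (b t)) (Set.Ici t) t := by
  rw [← hasDerivWithinAt_Ioi_iff_Ici, hasDerivWithinAt_iff_tendsto_slope' (by simp)]
  have h1 := (hL.tendsto ⟨T.avg r (w t), hL.avg_mem hr _⟩).add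
    (((T.avg r).continuous.tendsto _).comp (T.tendsto_inv_smul_integral hb t))
  have h4 : Filter.Tendsto (fun q : ℝ => q - t) (𝓝[>] t) (𝓝[>] 0) := by
    refine tendsto_nhdsWithin_iff.2 ⟨?_, ?_⟩
    · have : Continuous fun q : ℝ => q - t := by fun_prop
      simpa using (this.tendsto t).mono_left nhdsWithin_le_nhds
    · filter_upwards [self_mem_nhdsWithin] with q hq
      exact sub_pos.2 (Set.mem_Ioi.1 hq)
  refine (h1.comp h4).congr' ?_
  filter_upwards [self_mem_nhdsWithin] with q hq
  have e := mild_add hb hw ht (sub_pos.2 (Set.mem_Ioi.1 hq)).le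
  rw [add_sub_cancel] at e
  simp only [Function.comp, slope, vsub_eq_sub, add_sub_cancel]
  rw [e, map_add, op_avg, map_smul, ← smul_add]
  congr 1
  abel

/-- Lyapunov decay along mild solutions. The differential inequality for `Φ` is only available on
the domain of `L`; it is transferred to the mild solution `w` with forcing `b` by averaging, which
needs an upper bound `ψ` that no longer involves the unbounded operator `L`. -/
theorem HasGenerator.lyapunov_decay {T : C0Semigroup E} {L : E →ₗ.[ℝ] E}
    (hL : T.HasGenerator L) {w b : ℝ → E} (hwc : Continuous w) (hb : Continuous b)
    (hw : ∀ t : ℝ, 0 ≤ t →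
      w t = T.op t.toNNReal (w 0) + ∫ s in (0 : ℝ)..t, T.op (t - s).toNNReal (b s))
    {O : Set E} (hO : IsOpen O) {Φ : E → ℝ} (hΦ : Differentiable ℝ Φ)
    {ψ : E × E → ℝ} (hψ : Continuous ψ)
    (hdiss : ∀ x : L.domain, (x : E) ∈ O → ∀ v, fderiv ℝ Φ x (L x + v) ≤ ψ (x, v))
    {a t : ℝ} (ha : 0 < a) (ht : 0 ≤ t) (hwO : ∀ s ∈ Set.Icc 0 t, w s ∈ O)
    (hψw : ∀ s ∈ Set.Icc 0 t, ψ (w s, b s) ≤ -a * Φ (w s)) :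
    Φ (w t) ≤ Φ (w 0) * Real.exp (-a * t) := by
  have hcw : Continuous fun p : ℝ × ℝ => T.avg p.1 (w p.2) :=
    T.continuous_avg_apply.comp (continuous_fst.prodMk (hwc.comp continuous_snd))
  have hcb : Continuous fun p : ℝ × ℝ => T.avg p.1 (b p.2) :=
    T.continuous_avg_apply.comp (continuous_fst.prodMk (hb.comp continuous_snd))
  have hΦc := hΦ.continuous
  have hlim : ∀ s, Filter.Tendsto (fun r => Φ (T.avg r (w s))) (𝓝[>] 0) (𝓝 (Φ (w s))) := by
    intro s
    have : Continuous fun r : ℝ => Φ (T.avg r (w s)) :=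
      hΦc.comp (hcw.comp (continuous_id.prodMk continuous_const))
    simpa [avg_zero] using (this.tendsto 0).mono_left (nhdsWithin_le_nhds (s := Set.Ioi 0))
  have step : ∀ ε > 0, Φ (w t) ≤ gronwallBound (Φ (w 0)) (-a) ε t := by
    intro ε hε
    -- by compactness of `[0, t]`, one averaging length works for all times
    have hev : ∀ᶠ r in 𝓝 (0 : ℝ), ∀ s ∈ Set.Icc 0 t, T.avg r (w s) ∈ O ∧
        ψ (T.avg r (w s), T.avg r (b s)) < -a * Φ (T.avg r (w s)) + ε := by
      refine isCompact_Icc.eventually_forall_of_forall_eventually fun s hs => ?_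
      have h1 : ∀ᶠ p : ℝ × ℝ in 𝓝 (0, s), T.avg p.1 (w p.2) ∈ O :=
        hcw.continuousAt.eventually (hO.mem_nhds (by simpa [avg_zero] using hwO s hs))
      have h2 : ∀ᶠ p : ℝ × ℝ in 𝓝 (0, s), ψ (T.avg p.1 (w p.2), T.avg p.1 (b p.2))
          < -a * Φ (T.avg p.1 (w p.2)) + ε := by
        refine (hψ.comp (hcw.prodMk hcb)).continuousAt.eventually_lt
          (g := fun p : ℝ × ℝ => -a * Φ (T.avg p.1 (w p.2)) + ε)
          (((hΦc.comp hcw).const_mul (-a)).add_const ε).continuousAt ?_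
        simpa [avg_zero] using lt_of_le_of_lt (hψw s hs) (lt_add_of_pos_right _ hε)
      exact h1.and h2
    have hgr : ∀ᶠ r in 𝓝[>] (0 : ℝ),
        Φ (T.avg r (w t)) ≤ gronwallBound (Φ (T.avg r (w 0))) (-a) ε t := by
      filter_upwards [nhdsWithin_le_nhds hev, self_mem_nhdsWithin] with r hr hr0
      have hd : ∀ s ∈ Set.Ico 0 t, HasDerivWithinAt (fun s => Φ (T.avg r (w s)))
          (fderiv ℝ Φ (T.avg r (w s))
            (L ⟨T.avg r (w s), hL.avg_mem hr0 _⟩ + T.avg r (b s))) (Set.Ici s) s := fun s hs =>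
        (hΦ _).hasFDerivAt.comp_hasDerivWithinAt s (hL.hasDerivWithinAt_avg hb hw hr0 hs.1)
      have := le_gronwallBound_of_liminf_deriv_right_le
        (f := fun s => Φ (T.avg r (w s)))
        (f' := fun s => fderiv ℝ Φ (T.avg r (w s))
            (L ⟨T.avg r (w s), hL.avg_mem hr0 _⟩ + T.avg r (b s)))
        (δ := Φ (T.avg r (w 0))) (K := -a) (ε := ε) (a := 0) (b := t)
        (hΦc.comp (hcw.comp (continuous_const.prodMk continuous_id))).continuousOn
        (fun s hs q hq => (hd s hs).liminf_right_slope_le hq) le_rfl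
        (fun s hs => (hdiss ⟨_, hL.avg_mem hr0 _⟩ (hr s (Set.Ico_subset_Icc_self hs)).1 _).trans
          (hr s (Set.Ico_subset_Icc_self hs)).2.le) t ⟨ht, le_rfl⟩
      simpa using this
    refine le_of_tendsto_of_tendsto (hlim t) ?_ hgr
    simp only [gronwallBound_of_K_ne_0 (neg_ne_zero.2 ha.ne')]
    exact ((hlim 0).mul_const _).add_const _
  have h0 := (gronwallBound_continuous_ε (Φ (w 0)) (-a) t).tendsto 0
  rw [gronwallBound_ε0] at h0
  refine ge_of_tendsto (h0.mono_left (nhdsWithin_le_nhds (s := Set.Ioi 0))) ?_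
  filter_upwards [self_mem_nhdsWithin] with ε hε using step ε hε

end C0Semigroup

/-! ### The semigroup of the cascade -/

namespace C0Semigroup

variable {X Y : Type*} [NormedAddCommGroup X] [NormedSpace ℝ X]
  [NormedAddCommGroup Y] [NormedSpace ℝ Y]

/-- An output operator bounded for the graph norm is continuous along graph-norm convergence. -/
theorem tendsto_of_graph_bound {A : X →ₗ.[ℝ] X} {C : A.domain →ₗ[ℝ] Y}
    (hC : ∃ c : ℝ, ∀ x : A.domain, ‖C x‖ ≤ c * (‖(x : X)‖ + ‖A x‖))
    {α : Type*} {l : Filter α} {y : α → A.domain} {y₀ : A.domain}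
    (h1 : Filter.Tendsto (fun a => (y a : X)) l (𝓝 y₀))
    (h2 : Filter.Tendsto (fun a => A (y a)) l (𝓝 (A y₀))) :
    Filter.Tendsto (fun a => C (y a)) l (𝓝 (C y₀)) := by
  obtain ⟨c, hc⟩ := hC
  rw [tendsto_iff_norm_sub_tendsto_zero] at h1 h2 ⊢
  have h3 := (h1.add h2).const_mul c
  rw [add_zero, mul_zero] at h3
  refine squeeze_zero (fun _ => norm_nonneg _) (fun a => ?_) h3
  have := hc (y a - y₀)
  rwa [map_sub, A.map_sub] at this

variable [CompleteSpace X]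

/-- The integrated output `x ↦ C ∫₀ᵗ T(s) x ds`. -/
noncomputable def integratedOutput {T : C0Semigroup X} {A : X →ₗ.[ℝ] X} (hA : T.HasGenerator A)
    {C : A.domain →ₗ[ℝ] Y}
    (hC : ∃ c : ℝ, ∀ x : A.domain, ‖C x‖ ≤ c * (‖(x : X)‖ + ‖A x‖)) (t : ℝ≥0) : X →L[ℝ] Y where
  toFun x := C ⟨(t : ℝ) • T.avg t x, (hA.smul_avg_mem t x).1⟩
  map_add' x y := by
    rw [← map_add]
    congr 1
    ext
    simp
  map_smul' c x := by
    rw [RingHom.id_apply, ← C.map_smul]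
    congr 1
    ext
    simp [smul_comm c]
  cont := by
    rw [continuous_iff_continuousAt]
    intro x
    refine tendsto_of_graph_bound hC ?_ ?_
    · exact ((T.avg t).continuous.const_smul (t : ℝ)).tendsto x
    · simp only [(hA.smul_avg_mem t _).2]
      exact ((T.op t).continuous.sub continuous_id).tendsto x

theorem integratedOutput_apply {T : C0Semigroup X} {A : X →ₗ.[ℝ] X} (hA : T.HasGenerator A)
    {C : A.domain →ₗ[ℝ] Y}
    (hC : ∃ c : ℝ, ∀ x : A.domain, ‖C x‖ ≤ c * (‖(x : X)‖ + ‖A x‖)) (t : ℝ≥0) (x : X) :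
    integratedOutput hA hC t x = C ⟨(t : ℝ) • T.avg t x, (hA.smul_avg_mem t x).1⟩ := rfl

/-- The cascade semigroup `(x, z) ↦ (T(t) x, z + C ∫₀ᵗ T(s) x ds)`. -/
noncomputable def cascade {T : C0Semigroup X} {A : X →ₗ.[ℝ] X} (hA : T.HasGenerator A)
    {C : A.domain →ₗ[ℝ] Y}
    (hC : ∃ c : ℝ, ∀ x : A.domain, ‖C x‖ ≤ c * (‖(x : X)‖ + ‖A x‖)) : C0Semigroup (X × Y) where
  op t := ((T.op t).comp (ContinuousLinearMap.fst ℝ X Y)).prod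
    (ContinuousLinearMap.snd ℝ X Y
      + (integratedOutput hA hC t).comp (ContinuousLinearMap.fst ℝ X Y))
  op_zero := by
    refine ContinuousLinearMap.ext fun w => Prod.ext ?_ ?_
    · simp [op_zero_apply]
    · have : integratedOutput hA hC 0 = 0 := by
        ext x
        have h0 : (⟨((0 : ℝ≥0) : ℝ) • T.avg (0 : ℝ≥0) x, (hA.smul_avg_mem 0 x).1⟩ : A.domain)
            = 0 := by
          ext
          simp
        rw [integratedOutput_apply, h0, map_zero, _root_.zero_apply]
      simp [this]
  op_add s t := by
    refine ContinuousLinearMap.ext fun w => Prod.ext ?_ ?_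
    · simp [op_add_apply]
    · have : integratedOutput hA hC (s + t) w.1
          = integratedOutput hA hC t w.1 + integratedOutput hA hC s (T.op t w.1) := by
        rw [integratedOutput_apply, integratedOutput_apply, integratedOutput_apply, ← map_add]
        congr 1
        ext
        have h := T.op_smul_avg t s w.1
        rw [map_smul, op_avg] at h
        change _ = (t : ℝ) • T.avg t w.1 + (s : ℝ) • T.avg s (T.op t w.1)
        rw [h, add_sub_cancel]
      simp [this, add_assoc]
  strong_continuous w := by
    refine (T.strong_continuous w.1).prodMk (continuous_const.add ?_)
    change Continuous fun t => integratedOutput hA hC t w.1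
    rw [continuous_iff_continuousAt]
    intro t
    refine tendsto_of_graph_bound hC ?_ ?_
    · have : Continuous fun t : ℝ≥0 => (t : ℝ) • T.avg t w.1 :=
        NNReal.continuous_coe.smul
          (T.continuous_avg_apply.comp (NNReal.continuous_coe.prodMk continuous_const))
      exact this.tendsto t
    · simp only [(hA.smul_avg_mem _ _).2]
      exact ((T.strong_continuous w.1).sub continuous_const).tendsto t

theorem cascade_op_apply {T : C0Semigroup X} {A : X →ₗ.[ℝ] X} (hA : T.HasGenerator A)
    {C : A.domain →ₗ[ℝ] Y}
    (hC : ∃ c : ℝ, ∀ x : A.domain, ‖C x‖ ≤ c * (‖(x : X)‖ + ‖A x‖)) (t : ℝ≥0) (w : X × Y) :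
    (cascade hA hC).op t w = (T.op t w.1, w.2 + integratedOutput hA hC t w.1) := rfl

theorem hasGenerator_cascade {T : C0Semigroup X} {A : X →ₗ.[ℝ] X} (hA : T.HasGenerator A)
    {C : A.domain →ₗ[ℝ] Y}
    (hC : ∃ c : ℝ, ∀ x : A.domain, ‖C x‖ ≤ c * (‖(x : X)‖ + ‖A x‖)) :
    (cascade hA hC).HasGenerator (cascadeOperator A C) := by
  -- on the domain, the difference quotient of the second component is `C` of an average
  have hlim : ∀ x : A.domain, Filter.Tendsto
      (fun t : ℝ≥0 => (t : ℝ)⁻¹ • integratedOutput hA hC t x) (𝓝[>] 0) (𝓝 (C x)) := by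
    intro x
    have h1 : Filter.Tendsto (fun t : ℝ≥0 => T.avg t x) (𝓝[>] 0) (𝓝 x) := by
      have : Continuous fun t : ℝ≥0 => T.avg t (x : X) :=
        T.continuous_avg_apply.comp (NNReal.continuous_coe.prodMk continuous_const)
      simpa [avg_zero] using (this.tendsto 0).mono_left (nhdsWithin_le_nhds (s := Set.Ioi 0))
    refine tendsto_of_graph_bound (y := fun t : ℝ≥0 => (t : ℝ)⁻¹ •
      (⟨(t : ℝ) • T.avg t (x : X), (hA.smul_avg_mem t (x : X)).1⟩ : A.domain)) hC ?_ ?_ |>.congr ?_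
    · refine h1.congr' ?_
      filter_upwards [self_mem_nhdsWithin] with t ht
      have : (t : ℝ) ≠ 0 := (NNReal.coe_pos.2 ht).ne'
      simp [smul_smul, inv_mul_cancel₀ this]
    · simp only [A.map_smul, (hA.smul_avg_mem _ _).2]
      exact (hA x (A x)).1 ⟨x.2, rfl⟩
    · intro t
      rw [map_smul, integratedOutput_apply]
  have hsplit : ∀ (w : X × Y) (t : ℝ≥0), (t : ℝ)⁻¹ • ((cascade hA hC).op t w - w)
      = ((t : ℝ)⁻¹ • (T.op t w.1 - w.1), (t : ℝ)⁻¹ • integratedOutput hA hC t w.1) := by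
    intro w t
    rw [cascade_op_apply]
    ext <;> simp
  intro w v
  obtain ⟨v₁, v₂⟩ := v
  simp only [hsplit]
  rw [nhds_prod_eq, Filter.tendsto_prod_iff']
  constructor
  · rintro ⟨hw, hv⟩
    have hx : w.1 ∈ A.domain := hw.1
    obtain ⟨rfl, rfl⟩ := Prod.ext_iff.1 hv
    exact ⟨(hA _ _).1 ⟨hx, rfl⟩, hlim ⟨w.1, hx⟩⟩
  · rintro ⟨h1, h2⟩
    obtain ⟨hx, hAx⟩ := (hA _ _).2 h1
    refine ⟨⟨hx, trivial⟩, Prod.ext hAx ?_⟩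
    exact tendsto_nhds_unique (hlim ⟨w.1, hx⟩) h2

end C0Semigroup

/-! ### Lipschitz continuity on bounded sets and the radial retraction -/

section Lipschitz

variable {E F : Type*} [NormedAddCommGroup E] [NormedAddCommGroup F]

theorem LipschitzOnBounded.continuous {f : E → F} (hf : LipschitzOnBounded f) : Continuous f := by
  rw [continuous_iff_continuousAt]
  intro x
  obtain ⟨K, hK⟩ := hf _ (Metric.isBounded_ball (x := x) (r := 1))
  exact hK.continuousOn.continuousAt (Metric.ball_mem_nhds x one_pos)

theorem LipschitzOnBounded.exists_norm_sub_le {f : E → F} (hf : LipschitzOnBounded f) (R : ℝ) :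
    ∃ K : ℝ, 0 ≤ K ∧ ∀ x y, ‖x‖ ≤ R → ‖y‖ ≤ R → ‖f x - f y‖ ≤ K * ‖x - y‖ := by
  obtain ⟨K, hK⟩ := hf _ (Metric.isBounded_closedBall (x := 0) (r := R))
  refine ⟨K, K.2, fun x y hx hy => ?_⟩
  simpa [dist_eq_norm] using hK.dist_le_mul x (by simpa using hx) y (by simpa using hy)

theorem lipschitzOnBounded_of_norm_sub_le {f : E → F}
    (h : ∀ R : ℝ, ∃ K : ℝ, 0 ≤ K ∧ ∀ x y, ‖x‖ ≤ R → ‖y‖ ≤ R → ‖f x - f y‖ ≤ K * ‖x - y‖) :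
    LipschitzOnBounded f := by
  intro B hB
  obtain ⟨R, hR⟩ := hB.exists_norm_le
  obtain ⟨K, hK0, hK⟩ := h R
  refine ⟨K.toNNReal, LipschitzOnWith.of_dist_le_mul fun x hx y hy => ?_⟩
  simpa [dist_eq_norm, hK0] using hK x y (hR x hx) (hR y hy)

theorem LipschitzOnBounded.exists_norm_le {f : E → F} (hf : LipschitzOnBounded f) (R : ℝ) :
    ∃ K : ℝ, 0 ≤ K ∧ ∀ x, ‖x‖ ≤ R → ‖f x‖ ≤ K := by
  obtain ⟨K, hK0, hK⟩ := hf.exists_norm_sub_le (max R 0)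
  refine ⟨K * max R 0 + ‖f 0‖, by positivity, fun x hx => ?_⟩
  have h1 := hK x 0 (hx.trans (le_max_left _ _)) (by simp)
  rw [sub_zero] at h1
  have h2 : K * ‖x‖ ≤ K * max R 0 := mul_le_mul_of_nonneg_left (hx.trans (le_max_left _ _)) hK0
  linarith [norm_le_norm_sub_add (f x) (f 0)]

variable [NormedSpace ℝ E]

/-- The radial retraction onto the closed ball of radius `R` around zero. -/
noncomputable def radialRetraction (R : ℝ) (x : E) : E := (R / max R ‖x‖) • x

theorem radialRetraction_of_norm_le {R : ℝ} (hR : 0 < R) {x : E} (hx : ‖x‖ ≤ R) :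
    radialRetraction R x = x := by
  rw [radialRetraction, max_eq_left hx, div_self hR.ne', one_smul]

theorem norm_radialRetraction_le {R : ℝ} (hR : 0 < R) (x : E) : ‖radialRetraction R x‖ ≤ R := by
  have h : 0 < max R ‖x‖ := lt_max_of_lt_left hR
  rw [radialRetraction, norm_smul, Real.norm_of_nonneg (by positivity), div_mul_eq_mul_div,
    div_le_iff₀ h]
  exact mul_le_mul_of_nonneg_left (le_max_right _ _) hR.le

theorem norm_radialRetraction_sub_le {R : ℝ} (hR : 0 < R) (x y : E) :
    ‖radialRetraction R x - radialRetraction R y‖ ≤ 2 * ‖x - y‖ := by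
  have hx : 0 < max R ‖x‖ := lt_max_of_lt_left hR
  have hy : 0 < max R ‖y‖ := lt_max_of_lt_left hR
  have e : radialRetraction R x - radialRetraction R y
      = (R / max R ‖x‖) • (x - y) + (R / max R ‖x‖ - R / max R ‖y‖) • y := by
    simp only [radialRetraction, smul_sub, sub_smul]
    abel
  have h1 : ‖(R / max R ‖x‖) • (x - y)‖ ≤ ‖x - y‖ := by
    rw [norm_smul, Real.norm_of_nonneg (by positivity)]
    exact mul_le_of_le_one_left (norm_nonneg _) ((div_le_one hx).2 (le_max_left _ _))
  have h2 : ‖(R / max R ‖x‖ - R / max R ‖y‖) • y‖ ≤ ‖x - y‖ := by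
    have e2 : R / max R ‖x‖ - R / max R ‖y‖
        = R * (max R ‖y‖ - max R ‖x‖) / (max R ‖x‖ * max R ‖y‖) := by
      field_simp
    have h3 : |max R ‖y‖ - max R ‖x‖| ≤ ‖x - y‖ := by
      rw [norm_sub_rev]
      refine (abs_max_sub_max_le_max R ‖y‖ R ‖x‖).trans ?_
      simpa using abs_norm_sub_norm_le y x
    rw [e2, norm_smul, Real.norm_eq_abs, abs_div, abs_mul, abs_of_pos hR,
      abs_of_pos (mul_pos hx hy), div_mul_eq_mul_div, div_le_iff₀ (mul_pos hx hy)]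
    calc R * |max R ‖y‖ - max R ‖x‖| * ‖y‖ = |max R ‖y‖ - max R ‖x‖| * (R * ‖y‖) := by ring
      _ ≤ ‖x - y‖ * (max R ‖x‖ * max R ‖y‖) := by
        refine mul_le_mul h3 (mul_le_mul (le_max_left _ _) (le_max_right _ _) (norm_nonneg _) hx.le)
          (by positivity) (norm_nonneg _)
  rw [e]
  linarith [norm_add_le ((R / max R ‖x‖) • (x - y)) ((R / max R ‖x‖ - R / max R ‖y‖) • y)]

end Lipschitz

section Lipschitz

variable {E G H : Type*} [NormedAddCommGroup E] [NormedAddCommGroup G] [NormedAddCommGroup H]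

theorem LipschitzOnBounded.add {p q : E → G} (hp : LipschitzOnBounded p)
    (hq : LipschitzOnBounded q) : LipschitzOnBounded fun x => p x + q x := by
  intro B hB
  obtain ⟨K₁, h₁⟩ := hp B hB
  obtain ⟨K₂, h₂⟩ := hq B hB
  exact ⟨K₁ + K₂, h₁.add h₂⟩

theorem LipschitzOnBounded.sub {p q : E → G} (hp : LipschitzOnBounded p)
    (hq : LipschitzOnBounded q) : LipschitzOnBounded fun x => p x - q x := by
  intro B hB
  obtain ⟨K₁, h₁⟩ := hp B hB
  obtain ⟨K₂, h₂⟩ := hq B hB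
  exact ⟨K₁ + K₂, h₁.sub h₂⟩

theorem LipschitzOnBounded.prodMk {p : E → G} {q : E → H} (hp : LipschitzOnBounded p)
    (hq : LipschitzOnBounded q) : LipschitzOnBounded fun x => (p x, q x) := by
  intro B hB
  obtain ⟨K₁, h₁⟩ := hp B hB
  obtain ⟨K₂, h₂⟩ := hq B hB
  exact ⟨max K₁ K₂, h₁.prodMk h₂⟩

theorem LipschitzOnBounded.comp_fst {p : E → G} (hp : LipschitzOnBounded p) :
    LipschitzOnBounded fun x : E × H => p x.1 := by
  refine lipschitzOnBounded_of_norm_sub_le fun R => ?_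
  obtain ⟨K, hK0, hK⟩ := hp.exists_norm_sub_le R
  refine ⟨K, hK0, fun x y hx hy => ?_⟩
  refine (hK _ _ ((norm_fst_le x).trans hx) ((norm_fst_le y).trans hy)).trans ?_
  exact mul_le_mul_of_nonneg_left (norm_fst_le (x - y)) hK0

variable [NormedSpace ℝ G] [NormedSpace ℝ H]

theorem ContinuousLinearMap.lipschitzOnBounded (P : G →L[ℝ] H) : LipschitzOnBounded P :=
  fun _ _ => ⟨_, P.lipschitz.lipschitzOnWith⟩

theorem LipschitzOnBounded.clm_apply {P : E → G →L[ℝ] H} {q : E → G} (hP : LipschitzOnBounded P)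
    (hq : LipschitzOnBounded q) : LipschitzOnBounded fun x => P x (q x) := by
  refine lipschitzOnBounded_of_norm_sub_le fun R => ?_
  obtain ⟨K₁, hK₁0, hK₁⟩ := hP.exists_norm_sub_le R
  obtain ⟨K₂, hK₂0, hK₂⟩ := hq.exists_norm_sub_le R
  obtain ⟨C₁, hC₁0, hC₁⟩ := hP.exists_norm_le R
  obtain ⟨C₂, hC₂0, hC₂⟩ := hq.exists_norm_le R
  refine ⟨C₁ * K₂ + K₁ * C₂, by positivity, fun x y hx hy => ?_⟩
  have e : P x (q x) - P y (q y) = P x (q x - q y) + (P x - P y) (q y) := by simp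
  have h1 := (P x).le_of_opNorm_le_of_le (hC₁ x hx) (hK₂ x y hx hy)
  have h2 := (P x - P y).le_of_opNorm_le_of_le (hK₁ x y hx hy) (hC₂ y hy)
  rw [e]
  refine (norm_add_le_of_le h1 h2).trans (le_of_eq ?_)
  ring

/-- A map whose derivative is Lipschitz on bounded sets is Lipschitz on bounded sets. -/
theorem LipschitzOnBounded.of_fderiv {M : G → H} (hM : Differentiable ℝ M)
    (hdM : LipschitzOnBounded (fderiv ℝ M)) : LipschitzOnBounded M := by
  refine lipschitzOnBounded_of_norm_sub_le fun R => ?_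
  obtain ⟨K, hK0, hK⟩ := hdM.exists_norm_le R
  refine ⟨K, hK0, fun x y hx hy => ?_⟩
  exact (convex_closedBall (0 : G) R).norm_image_sub_le_of_norm_fderiv_le
    (fun z _ => hM z) (fun z hz => hK z (by simpa using hz)) (by simpa using hy)
    (by simpa using hx)

end Lipschitz

theorem LipschitzOnBounded.adjoint {E G H : Type*} [NormedAddCommGroup E]
    [NormedAddCommGroup G] [InnerProductSpace ℝ G] [CompleteSpace G]
    [NormedAddCommGroup H] [InnerProductSpace ℝ H] [CompleteSpace H]
    {P : E → G →L[ℝ] H} (hP : LipschitzOnBounded P) :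
    LipschitzOnBounded fun x => ContinuousLinearMap.adjoint (P x) := by
  intro B hB
  obtain ⟨K, h⟩ := hP B hB
  refine ⟨K, fun x hx y hy => ?_⟩
  simpa using h hx hy

/-! ### Existence and uniqueness of mild solutions -/

namespace C0Semigroup

variable {E : Type*} [NormedAddCommGroup E] [NormedSpace ℝ E]

/-- If the semigroup grows at rate `ω` and the forcing at a rate `lam > ω`, then the convolution
grows at rate `lam`, with a constant of order `1 / (lam - ω)`. -/
theorem norm_convolution_le {T : C0Semigroup E} {K ω : ℝ} (hK : 0 ≤ K)
    (hT : ∀ t : ℝ≥0, ‖T.op t‖ ≤ K * Real.exp (ω * t)) {c : ℝ → E} {B lam : ℝ} (hB : 0 ≤ B)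
    (hlam : ω < lam) (hcB : ∀ s, 0 ≤ s → ‖c s‖ ≤ B * Real.exp (lam * s)) {t : ℝ} (ht : 0 ≤ t) :
    ‖∫ s in (0 : ℝ)..t, T.op (t - s).toNNReal (c s)‖
      ≤ K * B / (lam - ω) * Real.exp (lam * t) := by
  have hμ : 0 < lam - ω := sub_pos.2 hlam
  have h1 : ∀ s ∈ Set.Ioc 0 t, ‖T.op (t - s).toNNReal (c s)‖
      ≤ K * B * Real.exp (ω * t) * Real.exp ((lam - ω) * s) := by
    intro s hs
    calc ‖T.op (t - s).toNNReal (c s)‖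
        ≤ (K * Real.exp (ω * (t - s))) * (B * Real.exp (lam * s)) := by
          refine (T.op _).le_of_opNorm_le_of_le ?_ (hcB s hs.1.le)
          have := hT (t - s).toNNReal
          rwa [Real.coe_toNNReal _ (sub_nonneg.2 hs.2)] at this
      _ = K * B * (Real.exp (ω * (t - s)) * Real.exp (lam * s)) := by ring
      _ = K * B * (Real.exp (ω * t) * Real.exp ((lam - ω) * s)) := by
          rw [← Real.exp_add, ← Real.exp_add]
          congr 2
          ring
      _ = _ := by ring
  refine (intervalIntegral.norm_integral_le_of_norm_le ht
    (Filter.Eventually.of_forall h1) (by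
      apply Continuous.intervalIntegrable
      fun_prop)).trans ?_
  rw [intervalIntegral.integral_const_mul,
    intervalIntegral.integral_comp_mul_left (fun s => Real.exp s) hμ.ne', integral_exp, mul_zero,
    Real.exp_zero, smul_eq_mul]
  have e : Real.exp (lam * t) = Real.exp (ω * t) * Real.exp ((lam - ω) * t) := by
    rw [← Real.exp_add]
    congr 1
    ring
  calc K * B * Real.exp (ω * t) * ((lam - ω)⁻¹ * (Real.exp ((lam - ω) * t) - 1))
      ≤ K * B * Real.exp (ω * t) * ((lam - ω)⁻¹ * Real.exp ((lam - ω) * t)) := by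
        gcongr
        linarith
    _ = _ := by
        rw [e]
        ring

variable [CompleteSpace E]

theorem continuous_convolution (T : C0Semigroup E) {c : ℝ → E} (hc : Continuous c) :
    Continuous fun t : ℝ => ∫ s in (0 : ℝ)..t, T.op (t - s).toNNReal (c s) := by
  refine intervalIntegral.continuous_parametric_intervalIntegral_of_continuous
    (f := fun t s : ℝ => T.op (t - s).toNNReal (c s)) ?_ continuous_id
  exact T.continuous_op_toNNReal (by fun_prop) (by fun_prop)

/-- Global existence of mild solutions for a globally Lipschitz perturbation: the variation of
constants map is a contraction in the norm `sup e^{-lam t} ‖w t‖` for large `lam`. -/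
theorem exists_mild (T : C0Semigroup E) {F : E → E} {Lc : ℝ} (hLc : 0 ≤ Lc)
    (hF : ∀ x y, ‖F x - F y‖ ≤ Lc * ‖x - y‖) (hF0 : F 0 = 0) (w₀ : E) :
    ∃ w : ℝ → E, Continuous w ∧ w 0 = w₀ ∧ ∀ t : ℝ, 0 ≤ t →
      w t = T.op t.toNNReal w₀ + ∫ s in (0 : ℝ)..t, T.op (t - s).toNNReal (F (w s)) := by
  obtain ⟨K, ω, hK1, hT⟩ := T.exists_norm_op_le_exp
  have hK : 0 ≤ K := by linarith
  have hFc : Continuous F :=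
    (LipschitzWith.of_dist_le_mul (K := Lc.toNNReal)
      (fun x y => by simpa [dist_eq_norm, hLc] using hF x y)).continuous
  set lam : ℝ := ω + 2 * (K * Lc) + 1 with hlam
  have hKL : 0 ≤ K * Lc := by positivity
  have hgap : ω < lam := by linarith
  have hμ : 0 < lam - ω := sub_pos.2 hgap
  -- the unweighted curve of an element of the weighted space
  let u : BoundedContinuousFunction ℝ≥0 E → ℝ → E :=
    fun φ s => Real.exp (lam * s) • φ s.toNNReal
  have hu : ∀ φ, Continuous (u φ) := fun φ =>
    (Real.continuous_exp.comp (continuous_const_mul lam)).smul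
      (φ.continuous.comp continuous_real_toNNReal)
  have hub : ∀ φ ψ s, 0 ≤ s → ‖F (u φ s) - F (u ψ s)‖ ≤ (Lc * ‖φ - ψ‖) * Real.exp (lam * s) := by
    intro φ ψ s _
    refine (hF _ _).trans ?_
    have : u φ s - u ψ s = Real.exp (lam * s) • (φ - ψ) s.toNNReal := by
      simp [u, smul_sub]
    rw [this, norm_smul, Real.norm_of_nonneg (Real.exp_pos _).le, mul_assoc, mul_comm ‖φ - ψ‖]
    gcongr
    exact (φ - ψ).norm_coe_le_norm _
  have hu0 : ∀ s, u 0 s = 0 := fun s => by simp [u]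
  let N : BoundedContinuousFunction ℝ≥0 E → ℝ → E := fun φ t =>
    Real.exp (-(lam * t)) • (T.op t.toNNReal w₀
      + ∫ s in (0 : ℝ)..t, T.op (t - s).toNNReal (F (u φ s)))
  have hN : ∀ φ, Continuous (N φ) := fun φ =>
    (Real.continuous_exp.comp (continuous_const_mul lam).neg).smul
      ((T.continuous_orbit w₀).add (T.continuous_convolution (hFc.comp (hu φ))))
  have hNb : ∀ φ (t : ℝ≥0), ‖N φ t‖ ≤ K * ‖w₀‖ + K * (Lc * ‖φ‖) / (lam - ω) := by
    intro φ t
    have h1 : ‖T.op (t : ℝ).toNNReal w₀‖ ≤ K * Real.exp (lam * t) * ‖w₀‖ := by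
      rw [Real.toNNReal_coe]
      refine (T.op t).le_of_opNorm_le ((hT t).trans ?_) _
      gcongr
    have h2 := norm_convolution_le hK hT (c := fun s => F (u φ s)) (B := Lc * ‖φ‖)
      (by positivity) hgap (fun s hs => by simpa [hu0, hF0] using hub φ 0 s hs) (NNReal.coe_nonneg t)
    rw [norm_smul, Real.norm_of_nonneg (Real.exp_pos _).le, Real.exp_neg,
      inv_mul_le_iff₀ (Real.exp_pos _)]
    refine (norm_add_le_of_le h1 h2).trans (le_of_eq ?_)
    ring
  let Ψ : BoundedContinuousFunction ℝ≥0 E → BoundedContinuousFunction ℝ≥0 E := fun φ =>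
    BoundedContinuousFunction.ofNormedAddCommGroup (fun t : ℝ≥0 => N φ t)
      ((hN φ).comp NNReal.continuous_coe) _ (hNb φ)
  have hΨ : ContractingWith (1 / 2) Ψ := by
    refine ⟨by rw [← NNReal.coe_lt_coe]; norm_num, LipschitzWith.of_dist_le_mul fun φ ψ => ?_⟩
    refine (BoundedContinuousFunction.dist_le (by positivity)).2 fun t => ?_
    have hi : ∀ φ, IntervalIntegrable (fun s => T.op ((t : ℝ) - s).toNNReal (F (u φ s)))
        MeasureTheory.volume 0 t := fun φ =>
      (T.continuous_op_toNNReal (by fun_prop) (hFc.comp (hu φ))).intervalIntegrable _ _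
    have h2 := norm_convolution_le hK hT (c := fun s => F (u φ s) - F (u ψ s)) (B := Lc * ‖φ - ψ‖)
      (by positivity) hgap (hub φ ψ) (NNReal.coe_nonneg t)
    have e : N φ t - N ψ t = Real.exp (-(lam * t)) •
        ∫ s in (0 : ℝ)..t, T.op ((t : ℝ) - s).toNNReal (F (u φ s) - F (u ψ s)) := by
      simp only [N, ← smul_sub, map_sub]
      rw [intervalIntegral.integral_sub (hi φ) (hi ψ), add_sub_add_left_eq_sub]
    change dist (N φ t) (N ψ t) ≤ _
    rw [dist_eq_norm, dist_eq_norm, e, norm_smul, Real.norm_of_nonneg (Real.exp_pos _).le,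
      Real.exp_neg, inv_mul_le_iff₀ (Real.exp_pos _)]
    refine h2.trans ?_
    rw [mul_comm (Real.exp _)]
    refine mul_le_mul_of_nonneg_right ?_ (Real.exp_pos _).le
    rw [div_le_iff₀ hμ]
    have h3 : (((1 / 2 : ℝ≥0)) : ℝ) = 1 / 2 := by norm_num
    rw [h3, hlam]
    nlinarith [norm_nonneg (φ - ψ)]
  set φ := hΨ.fixedPoint with hφ
  have hfix : Ψ φ = φ := hΨ.fixedPoint_isFixedPt
  have hval : ∀ t : ℝ≥0, φ t = N φ t := fun t => by
    conv_lhs => rw [← hfix]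
    rfl
  refine ⟨u φ, hu φ, ?_, fun t ht => ?_⟩
  · have h1 : N φ (0 : ℝ≥0) = w₀ := by simp [N, op_zero_apply]
    change Real.exp (lam * 0) • φ (0 : ℝ).toNNReal = w₀
    rw [mul_zero, Real.exp_zero, one_smul, Real.toNNReal_zero, hval, h1]
  · have := hval t.toNNReal
    rw [Real.coe_toNNReal t ht] at this
    change Real.exp (lam * t) • φ t.toNNReal = _
    rw [this, smul_smul, ← Real.exp_add, add_neg_cancel, Real.exp_zero, one_smul]

/-- Uniqueness of mild solutions for a perturbation that is Lipschitz on bounded sets. -/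
theorem mild_unique (T : C0Semigroup E) {F : E → E} (hF : LipschitzOnBounded F) {v w : ℝ → E}
    (hvc : Continuous v) (hwc : Continuous w) (h0 : v 0 = w 0)
    (hv : ∀ t : ℝ, 0 ≤ t →
      v t = T.op t.toNNReal (v 0) + ∫ s in (0 : ℝ)..t, T.op (t - s).toNNReal (F (v s)))
    (hw : ∀ t : ℝ, 0 ≤ t →
      w t = T.op t.toNNReal (w 0) + ∫ s in (0 : ℝ)..t, T.op (t - s).toNNReal (F (w s)))
    {t : ℝ} (ht : 0 ≤ t) : v t = w t := by
  obtain ⟨R₁, hR₁⟩ := (isCompact_Icc (a := 0) (b := t)).exists_bound_of_continuousOn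
    hvc.continuousOn
  obtain ⟨R₂, hR₂⟩ := (isCompact_Icc (a := 0) (b := t)).exists_bound_of_continuousOn
    hwc.continuousOn
  obtain ⟨Lc, hLc, hL⟩ := hF.exists_norm_sub_le (max R₁ R₂)
  obtain ⟨K, hK1, hK⟩ := T.exists_norm_op_le t.toNNReal
  have hφc : Continuous fun s => ‖v s - w s‖ := by fun_prop
  have hφ : ∀ s ∈ Set.Icc 0 t, ‖v s - w s‖ ≤ K * Lc * ∫ q in (0 : ℝ)..s, ‖v q - w q‖ := by
    intro s hs
    have hi : ∀ u : ℝ → E, Continuous u →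
        IntervalIntegrable (fun q => T.op (s - q).toNNReal (F (u q)))
          MeasureTheory.volume 0 s := fun u hu =>
      (T.continuous_op_toNNReal (by fun_prop) (hF.continuous.comp hu)).intervalIntegrable _ _
    rw [hv s hs.1, hw s hs.1, h0, add_sub_add_left_eq_sub,
      ← intervalIntegral.integral_sub (hi v hvc) (hi w hwc),
      ← intervalIntegral.integral_const_mul]
    refine intervalIntegral.norm_integral_le_of_norm_le hs.1
      (Filter.Eventually.of_forall fun q hq => ?_)
      ((hφc.const_mul _).intervalIntegrable _ _)
    have hqt : q ∈ Set.Icc 0 t := ⟨hq.1.le, hq.2.trans hs.2⟩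
    rw [← map_sub, mul_assoc]
    refine (T.op _).le_of_opNorm_le_of_le (hK _ (Real.toNNReal_le_toNNReal ?_))
      (hL _ _ ((hR₁ q hqt).trans (le_max_left _ _)) ((hR₂ q hqt).trans (le_max_right _ _)))
    linarith [hqt.1, hs.2]
  have hd : ∀ s, HasDerivAt (fun s => ∫ q in (0 : ℝ)..s, ‖v q - w q‖) ‖v s - w s‖ s := fun s =>
    intervalIntegral.integral_hasDerivAt_right (hφc.intervalIntegrable _ _)
      (hφc.stronglyMeasurableAtFilter _ _) hφc.continuousAt
  have hz := eq_zero_of_abs_deriv_le_mul_abs_self_of_eq_zero_right (a := 0) (b := t)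
    (K := K * Lc)
    (fun s _ => (hd s).continuousAt.continuousWithinAt)
    (fun s _ => (hd s).hasDerivWithinAt) intervalIntegral.integral_same (fun s hs => by
      rw [norm_norm]
      refine (hφ s (Set.Ico_subset_Icc_self hs)).trans ?_
      gcongr
      exact Real.le_norm_self _) t ⟨ht, le_rfl⟩
  have := hφ t ⟨ht, le_rfl⟩
  rw [hz, mul_zero] at this
  exact sub_eq_zero.1 (norm_le_zero_iff.1 this)

end C0Semigroup

/-! ### Local exponential stability from a Lyapunov function -/

/-- A Lyapunov function on a ball yields local exponential stability for mild solutions. The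
perturbation is truncated outside the ball to have a global solution, and the decay of `Φ` keeps
that solution inside the ball, where the truncation is invisible. -/
theorem C0Semigroup.HasGenerator.locallyExponentiallyStable {E : Type*} [NormedAddCommGroup E]
    [NormedSpace ℝ E] [CompleteSpace E] {T : C0Semigroup E} {L : E →ₗ.[ℝ] E}
    (hL : T.HasGenerator L) {F : E → E} (hF : LipschitzOnBounded F) (hF0 : F 0 = 0)
    {Φ : E → ℝ} (hΦ : Differentiable ℝ Φ) {ψ : E × E → ℝ} (hψ : Continuous ψ)
    {ρ a c₁ c₂ : ℝ} (hρ : 0 < ρ) (ha : 0 < a) (hc₁ : 0 ≤ c₁)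
    (hdiss : ∀ x : L.domain, ‖(x : E)‖ < ρ → ∀ v, fderiv ℝ Φ x (L x + v) ≤ ψ (x, v))
    (hdecay : ∀ x, ‖x‖ < ρ → ψ (x, F x) ≤ -a * Φ x)
    (hlower : ∀ x, ‖x‖ < ρ → ‖x‖ ^ 2 ≤ c₁ * Φ x)
    (hupper : ∀ x, ‖x‖ < ρ → Φ x ≤ c₂ * ‖x‖ ^ 2) :
    LocallyExponentiallyStable L F := by
  obtain ⟨Lc, hLc, hFL⟩ := hF.exists_norm_sub_le ρ
  set G : E → E := fun x => F (radialRetraction ρ x) with hG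
  have hGL : ∀ x y, ‖G x - G y‖ ≤ (Lc * 2) * ‖x - y‖ := fun x y => by
    refine (hFL _ _ (norm_radialRetraction_le hρ x) (norm_radialRetraction_le hρ y)).trans ?_
    rw [mul_assoc]
    exact mul_le_mul_of_nonneg_left (norm_radialRetraction_sub_le hρ x y) hLc
  have hGc : Continuous G := (LipschitzWith.of_dist_le_mul (K := (Lc * 2).toNNReal) fun x y => by
    simpa [dist_eq_norm, hLc] using hGL x y).continuous
  have hGF : ∀ x, ‖x‖ ≤ ρ → G x = F x := fun x hx => by
    rw [hG]
    simp only [radialRetraction_of_norm_le hρ hx]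
  have hG0 : G 0 = 0 := by rw [hGF 0 (by simpa using hρ.le), hF0]
  set K : ℝ := Real.sqrt (c₁ * c₂) with hK
  have hK0 : 0 ≤ K := Real.sqrt_nonneg _
  refine ⟨ρ / (K + 1), K + 1, a / 2, by positivity, by positivity, by positivity,
    fun w₀ hw₀ => ?_⟩
  have hw₀K : (K + 1) * ‖w₀‖ < ρ := by
    rwa [lt_div_iff₀ (by positivity), mul_comm] at hw₀
  obtain ⟨w, hwc, hw0, hw⟩ := T.exists_mild (by positivity) hGL hG0 w₀
  -- decay as long as the solution stays in the ball
  have hloc : ∀ t, 0 ≤ t → (∀ s ∈ Set.Icc 0 t, ‖w s‖ < ρ) →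
      ‖w t‖ ≤ K * Real.exp (-(a / 2) * t) * ‖w₀‖ := by
    intro t ht hs
    have h1 := hL.lyapunov_decay hwc (hGc.comp hwc) (by rw [hw0]; exact hw) (O := {x | ‖x‖ < ρ})
      (isOpen_lt continuous_norm continuous_const) hΦ hψ hdiss ha ht hs (fun s hst => by
        simp only [Function.comp, hGF _ (hs s hst).le]
        exact hdecay _ (hs s hst))
    have h0 := hs 0 ⟨le_rfl, ht⟩
    have h2 : ‖w t‖ ^ 2 ≤ (c₁ * c₂) * (Real.exp (-(a / 2) * t) * ‖w₀‖) ^ 2 := by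
      have e : Real.exp (-a * t) = Real.exp (-(a / 2) * t) ^ 2 := by
        rw [← Real.exp_nat_mul]
        congr 1
        push_cast
        ring
      calc ‖w t‖ ^ 2 ≤ c₁ * Φ (w t) := hlower _ (hs t ⟨ht, le_rfl⟩)
        _ ≤ c₁ * ((c₂ * ‖w 0‖ ^ 2) * Real.exp (-a * t)) := by
          refine mul_le_mul_of_nonneg_left (h1.trans ?_) hc₁
          exact mul_le_mul_of_nonneg_right (hupper _ h0) (Real.exp_pos _).le
        _ = _ := by
          rw [hw0, e]
          ring
    rw [← Real.sqrt_sq (norm_nonneg (w t)), mul_assoc]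
    refine (Real.sqrt_le_sqrt h2).trans (le_of_eq ?_)
    rw [Real.sqrt_mul' _ (sq_nonneg _), Real.sqrt_sq (by positivity)]
  have hKw₀ : K * ‖w₀‖ < ρ := lt_of_le_of_lt (by linarith [norm_nonneg w₀]) hw₀K
  have hw₀ρ : ‖w₀‖ < ρ := by nlinarith [norm_nonneg w₀]
  have hstay : ∀ t, 0 ≤ t → ‖w t‖ < ρ := by
    by_contra! hcon
    obtain ⟨t, ht, htρ⟩ := hcon
    set Z : Set ℝ := {s | 0 ≤ s ∧ ρ ≤ ‖w s‖} with hZ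
    have hZc : IsClosed Z :=
      (isClosed_le continuous_const continuous_id).inter (isClosed_le continuous_const hwc.norm)
    have hZb : BddBelow Z := ⟨0, fun s hs => hs.1⟩
    have hmem : sInf Z ∈ Z := hZc.csInf_mem ⟨t, ht, htρ⟩ hZb
    have hpos : 0 < sInf Z := by
      refine lt_of_le_of_ne hmem.1 fun h => ?_
      have := hmem.2
      rw [← h, hw0] at this
      linarith
    have hlt : ∀ s, 0 ≤ s → s < sInf Z → ‖w s‖ < ρ := fun s hs hsZ => by
      by_contra! h
      exact absurd (csInf_le hZb (show s ∈ Z from ⟨hs, h⟩)) (not_le.2 hsZ)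
    have hle : ‖w (sInf Z)‖ ≤ K * ‖w₀‖ := by
      refine le_of_tendsto ((hwc.norm.tendsto _).mono_left
        (nhdsWithin_le_nhds (s := Set.Iio (sInf Z)))) ?_
      filter_upwards [Ioo_mem_nhdsLT hpos] with s hs
      refine (hloc s hs.1.le fun q hq => hlt q hq.1 (hq.2.trans_lt hs.2)).trans ?_
      refine mul_le_mul_of_nonneg_right (mul_le_of_le_one_right hK0 ?_) (norm_nonneg _)
      exact Real.exp_le_one_iff.2 (by nlinarith [hs.1])
    exact absurd hmem.2 (not_le.2 (hle.trans_lt hKw₀))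
  have hmild : ∀ t : ℝ, 0 ≤ t →
      w t = T.op t.toNNReal (w 0) + ∫ s in (0 : ℝ)..t, T.op (t - s).toNNReal (F (w s)) := by
    intro t ht
    rw [hw t ht, hw0]
    congr 1
    refine intervalIntegral.integral_congr fun s hs => ?_
    rw [Set.uIcc_of_le ht] at hs
    simp only [hGF _ (hstay s hs.1).le]
  refine ⟨w, hw0, ⟨hwc.continuousOn, T, hL, hmild⟩, ?_, fun t ht => ?_⟩
  · rintro v hv0 ⟨hvc, T', hT', hv⟩ t ht
    rw [hT'.op_eq hL] at hv
    -- only the values of `v` on `[0, ∞)` matter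
    have hvc' : Continuous fun s => v (max s 0) :=
      hvc.comp_continuous (by fun_prop) fun s => Set.mem_Ici.2 (le_max_right _ _)
    have := T.mild_unique hF hvc' hwc (by simp [hv0, hw0]) (fun t ht => by
      simp only [max_eq_left ht, max_self]
      rw [hv t ht]
      congr 1
      refine intervalIntegral.integral_congr fun s hs => ?_
      rw [Set.uIcc_of_le ht] at hs
      simp only [max_eq_left hs.1]) hmild ht
    simpa [max_eq_left ht] using this
  · refine (hloc t ht fun s hs => hstay s hs.1).trans ?_
    gcongr
    linarith

/-! ### The forwarding feedback -/

/-- The adjoint of a surjective operator between Hilbert spaces is bounded below: by the open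
mapping theorem `η = D u` with `‖u‖ ≤ C ‖η‖`, and `‖η‖² = ⟪D* η, u⟫`. -/
theorem ContinuousLinearMap.exists_le_norm_adjoint {U Y : Type*}
    [NormedAddCommGroup U] [InnerProductSpace ℝ U] [CompleteSpace U]
    [NormedAddCommGroup Y] [InnerProductSpace ℝ Y] [CompleteSpace Y]
    (D : U →L[ℝ] Y) (hD : Function.Surjective D) :
    ∃ c : ℝ, 0 < c ∧ ∀ η, c * ‖η‖ ≤ ‖ContinuousLinearMap.adjoint D η‖ := by
  obtain ⟨C, hC, h⟩ := D.exists_preimage_norm_le hD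
  refine ⟨C⁻¹, inv_pos.2 hC, fun η => ?_⟩
  obtain ⟨u, hu, hun⟩ := h η
  rw [inv_mul_le_iff₀ hC]
  rcases (norm_nonneg η).eq_or_lt with h0 | h0
  · rw [← h0]
    positivity
  refine le_of_mul_le_mul_right ?_ h0
  calc ‖η‖ * ‖η‖ = inner ℝ (ContinuousLinearMap.adjoint D η) u := by
        rw [ContinuousLinearMap.adjoint_inner_left, hu, real_inner_self_eq_norm_mul_norm]
    _ ≤ ‖ContinuousLinearMap.adjoint D η‖ * ‖u‖ := real_inner_le_norm _ _
    _ ≤ ‖ContinuousLinearMap.adjoint D η‖ * (C * ‖η‖) := by gcongr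
    _ = _ := by ring

section Forwarding

variable {X U Y : Type*}
  [NormedAddCommGroup X] [InnerProductSpace ℝ X] [CompleteSpace X]
  [NormedAddCommGroup U] [InnerProductSpace ℝ U] [CompleteSpace U]
  [NormedAddCommGroup Y] [InnerProductSpace ℝ Y] [CompleteSpace Y]

theorem lipschitzOnBounded_forwardingFeedback {g : X → U →L[ℝ] X} (hg : LipschitzOnBounded g)
    {M : X → Y} (hM : Differentiable ℝ M) (hdM : LipschitzOnBounded (fderiv ℝ M)) :
    LipschitzOnBounded fun w : X × Y => forwardingFeedback g M w.1 w.2 :=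
  hg.adjoint.comp_fst.clm_apply (hdM.adjoint.comp_fst.clm_apply
    ((ContinuousLinearMap.snd ℝ X Y).lipschitzOnBounded.sub
      (LipschitzOnBounded.of_fderiv hM hdM).comp_fst))

theorem lipschitzOnBounded_closedLoopPerturbation {f : X → X} (hf : LipschitzOnBounded f)
    {g : X → U →L[ℝ] X} (hg : LipschitzOnBounded g) {h : X → Y} (hh : LipschitzOnBounded h)
    (S : Y →L[ℝ] Y) {M : X → Y} (hM : Differentiable ℝ M)
    (hdM : LipschitzOnBounded (fderiv ℝ M)) :
    LipschitzOnBounded (closedLoopPerturbation f g h S M) :=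
  (hf.comp_fst.add
    (hg.comp_fst.clm_apply (lipschitzOnBounded_forwardingFeedback hg hM hdM))).prodMk
    ((S.comp (ContinuousLinearMap.snd ℝ X Y)).lipschitzOnBounded.add hh.comp_fst)

/-- By the range condition, the feedback controls the distance to the invariant graph near `0`. -/
theorem exists_le_norm_forwardingFeedback {g : X → U →L[ℝ] X} (hg : Continuous g)
    {M : X → Y} (hdM : Continuous (fderiv ℝ M))
    (hrange : Set.range (fun u : U => fderiv ℝ M 0 (g 0 u)) = Set.univ) :
    ∃ c ρ : ℝ, 0 < c ∧ 0 < ρ ∧ ∀ x : X, ‖x‖ < ρ → ∀ z : Y,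
      c * ‖z - M x‖ ≤ ‖forwardingFeedback g M x z‖ := by
  set D : X → U →L[ℝ] Y := fun x => (fderiv ℝ M x).comp (g x) with hD
  have hDc : Continuous D := hdM.clm_comp hg
  obtain ⟨c, hc, hcD⟩ := (D 0).exists_le_norm_adjoint (Set.range_eq_univ.1 hrange)
  obtain ⟨ρ, hρ, hball⟩ :=
    Metric.continuousAt_iff.1 (hDc.continuousAt (x := 0)) (c / 2) (half_pos hc)
  refine ⟨c / 2, ρ, half_pos hc, hρ, fun x hx z => ?_⟩
  have hu : forwardingFeedback g M x z = ContinuousLinearMap.adjoint (D x) (z - M x) := by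
    rw [hD]
    simp only [ContinuousLinearMap.adjoint_comp]
    rfl
  have h1 := @hball x (by simpa using hx)
  rw [dist_comm, dist_eq_norm, ← LinearIsometryEquiv.norm_map ContinuousLinearMap.adjoint,
    map_sub] at h1
  have h2 := (ContinuousLinearMap.adjoint (D 0)
    - ContinuousLinearMap.adjoint (D x)).le_of_opNorm_le h1.le (z - M x)
  rw [_root_.sub_apply] at h2
  rw [hu]
  have h3 := norm_le_norm_sub_add (ContinuousLinearMap.adjoint (D 0) (z - M x))
    (ContinuousLinearMap.adjoint (D x) (z - M x))
  linarith [hcD (z - M x)]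

theorem ContinuousLinearMap.inner_self_apply_eq_zero_of_adjoint_eq_neg {S : Y →L[ℝ] Y}
    (hS : ContinuousLinearMap.adjoint S = -S) (y : Y) : inner ℝ y (S y) = 0 := by
  have h := ContinuousLinearMap.adjoint_inner_left S y y
  rw [hS, _root_.neg_apply, inner_neg_left, real_inner_comm] at h
  linarith

end Forwarding

/-- The derivative of the Lyapunov functional `V(x) + β ‖z - M x‖²` in the direction `v`. -/
theorem fderiv_forwarding_lyapunov {X Y : Type*} [NormedAddCommGroup X] [NormedSpace ℝ X]
    [NormedAddCommGroup Y] [InnerProductSpace ℝ Y] {V : X → ℝ} (hV : Differentiable ℝ V) {M : X → Y}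
    (hM : Differentiable ℝ M) (β : ℝ) (w v : X × Y) :
    fderiv ℝ (fun w : X × Y => V w.1 + β * ‖w.2 - M w.1‖ ^ 2) w v
      = fderiv ℝ V w.1 v.1 + β * (2 * inner ℝ (w.2 - M w.1) (v.2 - fderiv ℝ M w.1 v.1)) := by
  have h1 : HasFDerivAt (fun w : X × Y => V w.1) _ w :=
    (hV w.1).hasFDerivAt.comp w hasFDerivAt_fst
  have h2 : HasFDerivAt (fun w : X × Y => M w.1) _ w :=
    (hM w.1).hasFDerivAt.comp w hasFDerivAt_fst
  have h3 : HasFDerivAt (fun w : X × Y => w.2 - M w.1) _ w := hasFDerivAt_snd.sub h2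
  have h4 : HasFDerivAt (fun w : X × Y => V w.1 + β * ‖w.2 - M w.1‖ ^ 2) _ w :=
    h1.add (h3.norm_sq.const_mul β)
  rw [h4.fderiv]
  simp [inner_sub_left, inner_sub_right]

/-! ### Stability of the closed loop -/

theorem mainTheorem2 {X U Y : Type*}
    [NormedAddCommGroup X] [InnerProductSpace ℝ X] [CompleteSpace X]
    [NormedAddCommGroup U] [InnerProductSpace ℝ U] [CompleteSpace U]
    [NormedAddCommGroup Y] [InnerProductSpace ℝ Y] [CompleteSpace Y]
    (A : X →ₗ.[ℝ] X) (hA : ∃ T : C0Semigroup X, T.HasGenerator A)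
    (f : X → X) (hf : LipschitzOnBounded f) (hf0 : f 0 = 0)
    (g : X → U →L[ℝ] X) (hg : LipschitzOnBounded g)
    (h : X → Y) (hh : LipschitzOnBounded h) (hh0 : h 0 = 0)
    (C : A.domain →ₗ[ℝ] Y)
    (hC : ∃ c : ℝ, ∀ x : A.domain, ‖C x‖ ≤ c * (‖(x : X)‖ + ‖A x‖))
    (S : Y →L[ℝ] Y) (hS : ContinuousLinearMap.adjoint S = -S)
    (hISS : SemiglobalISS A f g)
    (M : X → Y) (hM : IsInvariantGraph A f C h S M)
    (hrange : Set.range (fun u : U => fderiv ℝ M 0 (g 0 u)) = Set.univ) :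
    LocallyExponentiallyStable (cascadeOperator A C) (closedLoopPerturbation f g h S M) := by
  obtain ⟨T, hT⟩ := hA
  have hMd : Differentiable ℝ M := hM.contDiff.differentiable one_ne_zero
  have hdMc : Continuous (fderiv ℝ M) := hM.lipschitz_fderiv.continuous
  obtain ⟨c, ρ, hc, hρ, hcρ⟩ := exists_le_norm_forwardingFeedback hg.continuous hdMc hrange
  obtain ⟨V, ⟨hVC, m₁, m₂, hm₁, hm₂, hVm⟩, α, β, hα, hβ, hVdiss⟩ :=
    hISS.2 (Metric.ball 0 ρ) Metric.isOpen_ball Metric.isBounded_ball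
  obtain ⟨l, hl, hMl⟩ :=
    (LipschitzOnBounded.of_fderiv hMd hM.lipschitz_fderiv).exists_norm_sub_le ρ
  have hVd : Differentiable ℝ V := hVC.differentiable one_ne_zero
  have hdVc : Continuous (fderiv ℝ V) := hVC.continuous_fderiv one_ne_zero
  have hMl0 : ∀ x, ‖x‖ < ρ → ‖M x‖ ≤ l * ‖x‖ := fun x hx => by
    simpa [hM.map_zero] using hMl x 0 hx.le (by simpa using hρ.le)
  have hV0 : ∀ x, 0 ≤ V x := fun x => le_trans (by positivity) (hVm x).1
  set k : X × Y → U := fun w => forwardingFeedback g M w.1 w.2 with hk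
  have hkc : Continuous k :=
    (lipschitzOnBounded_forwardingFeedback hg hMd hM.lipschitz_fderiv).continuous
  have hfst : ∀ {w : X × Y}, ‖w‖ < ρ → ‖w.1‖ < ρ := fun {w} hw => (norm_fst_le w).trans_lt hw
  set Φ : X × Y → ℝ := fun w => V w.1 + β * ‖w.2 - M w.1‖ ^ 2 with hΦ
  have hΦd : Differentiable ℝ Φ :=
    (hVd.comp differentiable_fst).add
      (((differentiable_snd.sub (hMd.comp differentiable_fst)).norm_sq ℝ).const_mul β)
  have hfc := hf.continuous
  have hgc := hg.continuous
  have hhc := hh.continuous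
  have hMc := hMd.continuous
  have hVc := hVd.continuous
  -- the unbounded terms `A x` and `C x` of the derivative of `Φ` along the cascade are eliminated
  -- by the dissipation inequality for `V` and the invariance equation for `M`, respectively
  -- `c₁` comes from `‖z‖² ≤ 2 ‖η‖² + 2 l² ‖x‖²` and `c₂` from `‖η‖ ≤ (1 + l) ‖(x, z)‖`, where
  -- `η = z - M x` and `l` is a Lipschitz constant of `M`
  refine (C0Semigroup.hasGenerator_cascade hT hC).locallyExponentiallyStable
    (lipschitzOnBounded_closedLoopPerturbation hf hg hh S hMd hM.lipschitz_fderiv) ?_ hΦd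
    (ψ := fun p : (X × Y) × (X × Y) => -α * V p.1.1 + β * ‖k p.1‖ ^ 2
      + fderiv ℝ V p.1.1 (p.2.1 - f p.1.1 - g p.1.1 (k p.1))
      + β * (2 * inner ℝ (p.1.2 - M p.1.1)
        (p.2.2 - S (M p.1.1) - h p.1.1 - fderiv ℝ M p.1.1 (p.2.1 - f p.1.1))))
    ?_ (a := min α (c ^ 2)) (c₁ := m₁⁻¹ + 2 * β⁻¹ + 2 * l ^ 2 * m₁⁻¹)
    (c₂ := m₂ + β * (1 + l) ^ 2) hρ (lt_min hα (by positivity)) (by positivity) ?_ ?_ ?_ ?_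
  · simp [closedLoopPerturbation, forwardingFeedback, hf0, hh0, hM.map_zero]
  · have h1 : Continuous fun p : (X × Y) × (X × Y) =>
        fderiv ℝ V p.1.1 (p.2.1 - f p.1.1 - g p.1.1 (k p.1)) :=
      (hdVc.comp (by fun_prop)).clm_apply (((by fun_prop : Continuous fun p : (X × Y) × (X × Y) =>
        p.2.1 - f p.1.1)).sub ((hgc.comp (by fun_prop)).clm_apply (hkc.comp continuous_fst)))
    have h2 : Continuous fun p : (X × Y) × (X × Y) => fderiv ℝ M p.1.1 (p.2.1 - f p.1.1) :=
      (hdMc.comp (by fun_prop)).clm_apply (by fun_prop)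
    fun_prop
  · intro w hw v
    have hx : w.1.1 ∈ A.domain := w.2.1
    have e : cascadeOperator A C w = (A ⟨w.1.1, hx⟩, C ⟨w.1.1, hx⟩) := rfl
    have h1 := hVdiss ⟨w.1.1, hx⟩ (k w) (by simpa using hfst hw)
    have h2 := hM.sylvester ⟨w.1.1, hx⟩
    have e1 : A ⟨w.1.1, hx⟩ + v.1 = (A ⟨w.1.1, hx⟩ + f w.1.1 + g w.1.1 (k w))
        + (v.1 - f w.1.1 - g w.1.1 (k w)) := by abel
    have e2 : C ⟨w.1.1, hx⟩ + v.2 - fderiv ℝ M w.1.1 (A ⟨w.1.1, hx⟩ + v.1)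
        = v.2 - S (M w.1.1) - h w.1.1 - fderiv ℝ M w.1.1 (v.1 - f w.1.1) := by
      have e3 : A ⟨w.1.1, hx⟩ + v.1 = (A ⟨w.1.1, hx⟩ + f w.1.1) + (v.1 - f w.1.1) := by abel
      rw [e3, map_add, h2]
      abel
    rw [hΦ, fderiv_forwarding_lyapunov hVd hMd, e]
    simp only [Prod.fst_add, Prod.snd_add]
    rw [e2, e1, map_add]
    linarith
  · intro w hw
    have hskew := ContinuousLinearMap.inner_self_apply_eq_zero_of_adjoint_eq_neg hS (w.2 - M w.1)
    have hku : inner ℝ (w.2 - M w.1) (fderiv ℝ M w.1 (g w.1 (k w))) = ‖k w‖ ^ 2 := by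
      rw [← ContinuousLinearMap.adjoint_inner_left, ← ContinuousLinearMap.adjoint_inner_left,
        ← real_inner_self_eq_norm_sq]
      rfl
    have e : (closedLoopPerturbation f g h S M w) = (f w.1 + g w.1 (k w), S w.2 + h w.1) := rfl
    have e1 : S w.2 + h w.1 - S (M w.1) - h w.1 = S (w.2 - M w.1) := by
      rw [map_sub]
      abel
    simp only [e]
    rw [add_sub_cancel_left, sub_self, map_zero, e1, inner_sub_right, hskew, hku, hΦ]
    have h1 := hcρ w.1 (hfst hw) w.2
    have h2 : c ^ 2 * ‖w.2 - M w.1‖ ^ 2 ≤ ‖k w‖ ^ 2 := by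
      rw [← mul_pow]
      exact pow_le_pow_left₀ (by positivity) h1 2
    have h3 : min α (c ^ 2) * V w.1 ≤ α * V w.1 :=
      mul_le_mul_of_nonneg_right (min_le_left _ _) (hV0 _)
    have h4 : min α (c ^ 2) * ‖w.2 - M w.1‖ ^ 2 ≤ ‖k w‖ ^ 2 :=
      (mul_le_mul_of_nonneg_right (min_le_right _ _) (sq_nonneg _)).trans h2
    have h5 := mul_le_mul_of_nonneg_left h4 hβ.le
    linarith
  · intro w hw
    have h1 := (hVm w.1).1
    have h2 : ‖w.1‖ ^ 2 ≤ m₁⁻¹ * Φ w := by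
      rw [← div_eq_inv_mul, le_div_iff₀ hm₁, mul_comm]
      exact h1.trans (le_add_of_nonneg_right (by positivity))
    have h3 : ‖w.2 - M w.1‖ ^ 2 ≤ β⁻¹ * Φ w := by
      rw [← div_eq_inv_mul, le_div_iff₀ hβ, mul_comm]
      exact le_add_of_nonneg_left (hV0 _)
    have h4 : ‖w.2‖ ≤ ‖w.2 - M w.1‖ + l * ‖w.1‖ :=
      (norm_le_norm_sub_add _ _).trans (by gcongr; exact hMl0 _ (hfst hw))
    have h5 : ‖w.2‖ ^ 2 ≤ 2 * ‖w.2 - M w.1‖ ^ 2 + 2 * l ^ 2 * ‖w.1‖ ^ 2 := by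
      have := pow_le_pow_left₀ (norm_nonneg _) h4 2
      nlinarith [sq_nonneg (‖w.2 - M w.1‖ - l * ‖w.1‖)]
    have h6 : ‖w‖ ^ 2 ≤ ‖w.1‖ ^ 2 + ‖w.2‖ ^ 2 := by
      rw [Prod.norm_def]
      rcases max_choice ‖w.1‖ ‖w.2‖ with h | h <;> rw [h] <;>
        nlinarith [sq_nonneg ‖w.1‖, sq_nonneg ‖w.2‖]
    have h7 := mul_le_mul_of_nonneg_left h2 (by positivity : 0 ≤ 2 * l ^ 2)
    linarith
  · intro w hw
    have hw1 := norm_fst_le w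
    have hw2 := norm_snd_le w
    have h1 : ‖w.1‖ ^ 2 ≤ ‖w‖ ^ 2 := pow_le_pow_left₀ (norm_nonneg _) hw1 2
    have h2 : ‖w.2 - M w.1‖ ≤ (1 + l) * ‖w‖ := by
      have := mul_le_mul_of_nonneg_left hw1 hl
      linarith [norm_sub_le w.2 (M w.1), hMl0 _ (hfst hw)]
    have h3 : ‖w.2 - M w.1‖ ^ 2 ≤ (1 + l) ^ 2 * ‖w‖ ^ 2 := by
      rw [← mul_pow]
      exact pow_le_pow_left₀ (norm_nonneg _) h2 2
    have h4 := mul_le_mul_of_nonneg_left h3 hβ.le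
    have h5 := mul_le_mul_of_nonneg_left h1 hm₂.le
    have h6 := (hVm w.1).2
    rw [hΦ]
    simp only
    linarith
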